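/- Let $(\xi_1,\eta_1),(\xi_2,\eta_2),\ldots$ be independent copies of an $\mathbb{R}^2$-valued random vector $(\xi,\eta)$ with arbitrarily dependent components. Put $T_n:=\xi_1+\ldots+\xi_{n-1}+\eta_n$ for $n\ge 1$ and, for $t\in\mathbb{R}$, $$\tau(t):=\inf\{n\ge 1: T_n>t\},\qquad N(t):=\#\{n\ge 1: T_n\le t\},\qquad \rho(t):=\sup\{n\ge 1: T_n\le t\},$$ with $\inf\varnothing=\infty$ and $\sup\varnothing=0$. Suppose $\mu:=\mathbb{E}[\xi]\in(0,\infty)$ and $\sigma^2:=\operatorname{Var}[\xi]\in(0,\infty)$. Let $(B(u))_{u\ge 0}$ be a standard Brownian motion, and write $\overset{\mathrm{f.d.d.}}{\longrightarrow}$ for weak convergence of finite-dimensional distributions. With $x^+=\max(x,0)$ and $x^-=\max(-x,0)$, the following hold. (i) If $\mathbb{E}[\eta^+]<\infty$, then almost surely $\tau(t)<\infty$ for all $t\in\mathbb{R}$, and $$\Big(\frac{\tau(ut)-\mu^{-1}ut}{(\sigma^2\mu^{-3}t)^{1/2}}\Big)_{u\ge 0}\ \overset{\mathrm{f.d.d.}}{\longrightarrow}\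 (B(u))_{u\ge 0},\qquad t\to\infty.$$ (ii) If $\mathbb{E}[\eta^-]<\infty$, then almost surely $\rho(t)<\infty$ for all $t\in\mathbb{R}$, and $$\Big(\frac{\rho(ut)-\mu^{-1}ut}{(\sigma^2\mu^{-3}t)^{1/2}}\Big)_{u\ge 0}\ \overset{\mathrm{f.d.d.}}{\longrightarrow}\ (B(u))_{u\ge 0},\qquad t\to\infty.$$ (iii) If $\mathbb{E}|\eta|<\infty$, then almost surely $\tau(t)$, $N(t)$ and $\rho(t)$ are finite for all $t\in\mathbb{R}$, and $$\Big(\frac{\tau(ut)-\mu^{-1}ut}{(\sigma^2\mu^{-3}t)^{1/2}},\ \frac{N(ut)-\mu^{-1}ut}{(\sigma^2\mu^{-3}t)^{1/2}},\ \frac{\rho(ut)-\mu^{-1}ut}{(\sigma^2\mu^{-3}t)^{1/2}}\Big)_{u\ge 0}\ \overset{\mathrm{f.d.d.}}{\longrightarrow}\ \big(B(u),B(u),B(u)\big)_{u\ge 0},\qquad t\to\infty,$$ with the same Brownian motion in all three components. -/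

import Mathlib

open MeasureTheory ProbabilityTheory Filter
open scoped NNReal

namespace PerturbedWalk

section Walk

variable {Ω : Type*}

/-- The zero-delayed random walk `S_n = ξ_1 + ⋯ + ξ_n`. Sequences are indexed from zero:
`ξ k` is the increment `ξ_{k+1}`. -/
noncomputable def walk (ξ : ℕ → Ω → ℝ) (n : ℕ) (ω : Ω) : ℝ :=
  ∑ k ∈ Finset.range n, ξ k ω

/-- The globally perturbed random walk: `pertWalk ξ η n` is `T_{n+1} = S_n + η_{n+1}`. -/
noncomputable def pertWalk (ξ η : ℕ → Ω → ℝ) (n : ℕ) (ω : Ω) : ℝ :=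
  walk ξ n ω + η n ω

/-- The first passage time `τ(t) = inf {n ≥ 1 : T_n > t}`, with `inf ∅ = ∞`. -/
noncomputable def tau (ξ η : ℕ → Ω → ℝ) (t : ℝ) (ω : Ω) : ℕ∞ :=
  ⨅ (n : ℕ) (_ : t < pertWalk ξ η n ω), ((n + 1 : ℕ) : ℕ∞)

/-- The number of visits `N(t) = #{n ≥ 1 : T_n ≤ t}`, possibly infinite. -/
noncomputable def visits (ξ η : ℕ → Ω → ℝ) (t : ℝ) (ω : Ω) : ℕ∞ :=
  Set.encard {n : ℕ | pertWalk ξ η n ω ≤ t}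

/-- The last exit time `ρ(t) = sup {n ≥ 1 : T_n ≤ t}`, with `sup ∅ = 0`. -/
noncomputable def rho (ξ η : ℕ → Ω → ℝ) (t : ℝ) (ω : Ω) : ℕ∞ :=
  ⨆ (n : ℕ) (_ : pertWalk ξ η n ω ≤ t), ((n + 1 : ℕ) : ℕ∞)

/-- For a counting process `A` with values in `ℕ∞`, the process
`u ↦ (A(ut) - μ⁻¹ut) / (σ²μ⁻³t)^{1/2}`. Infinite values of `A` are replaced by `0`; this is used
only for processes which are almost surely finite. -/
noncomputable def normalized (μ σ : ℝ) (A : ℝ → Ω → ℕ∞) (t : ℝ) (u : ℝ≥0) (ω : Ω) : ℝ :=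
  (((A (u * t) ω).toNat : ℝ) - μ⁻¹ * (u * t)) / √(σ ^ 2 * (μ ^ 3)⁻¹ * t)

end Walk

/-- Weak convergence of the finite-dimensional distributions of the `E`-valued processes
`(X t u)_{u ≥ 0}` to those of `(Y u)_{u ≥ 0}`, as `t → ∞`. -/
def FDDConverge {Ω Ω' E : Type*} [MeasurableSpace Ω] [MeasurableSpace Ω']
    [TopologicalSpace E] [SecondCountableTopology E] [MeasurableSpace E] [OpensMeasurableSpace E]
    (X : ℝ → ℝ≥0 → Ω → E) (Y : ℝ≥0 → Ω' → E)
    (P : Measure Ω) [IsProbabilityMeasure P] (Q : Measure Ω') [IsProbabilityMeasure Q] : Prop :=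
  ∀ (k : ℕ) (u : Fin k → ℝ≥0),
    TendstoInDistribution (fun (t : ℝ) (ω : Ω) (i : Fin k) => X t (u i) ω) atTop
      (fun (ω : Ω') (i : Fin k) => Y (u i) ω) (fun _ => P) Q

end PerturbedWalk

/-! On the scale √t, all three counting processes follow one functional of the unperturbed walk S:
the normalized fluctuation Z_t of S at time t/μ (`fluct`). By Chebyshev's inequality, at n = t/μ +
x√t the walk is at t + μ√t(x − Z_t) + o(√t). Hence a random time A(t) satisfies (A(t) − t/μ)/√t −
Z_t → 0 in probability once two events are asymptotically negligible: A(t) > n with S_n ≥ t + c√t,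
and A(t) ≤ n with S_n ≤ t − c√t (`tendstoInMeasure_sub_fluct`). Tightness of Z reduces this to
finitely many x.

For ρ, the first event makes the perturbed walk restarted at n fall below −c√t. Its infimum is
almost surely finite when η⁻ is integrable, by the strong law. The second makes the single
perturbation in T_{n+1} at least c√t.

For τ, the first event makes S_n − T_n, a copy of ξ − η, at least c√t. In the second, S_n − T_{k+1}
≤ −c√t for some k < n. Read backwards from n, these differences form a perturbed walk with
perturbation ξ − η, whose negative part is at most |ξ| + η⁺, so the argument for ρ applies.

Since τ − 1 ≤ N ≤ ρ, N is squeezed between them. At time ut the common fluctuation is a rescaled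
partial sum of (μ − ξ)/σ, so a finite-dimensional central limit theorem, proved with characteristic
functions, and Slutsky's lemma finish the proof. -/

namespace PerturbedWalk

open scoped Topology ENNReal

/-! ### Drift of the perturbed walk and its infimum -/

section RandomWalk

variable {Ω : Type*} [MeasurableSpace Ω] {P : Measure Ω} {ξ η : ℕ → Ω → ℝ}

/-- The pairs `(ξ n, η n)` are independent copies of each other. -/
structure IsIIDPair (ξ η : ℕ → Ω → ℝ) (P : Measure Ω) : Prop where
  indep : iIndepFun (fun n ω => (ξ n ω, η n ω)) P
  ident : ∀ n, IdentDistrib (fun ω => (ξ n ω, η n ω)) (fun ω => (ξ 0 ω, η 0 ω)) P P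

namespace IsIIDPair

lemma map (h : IsIIDPair ξ η P) {f g : ℝ × ℝ → ℝ} (hf : Measurable f) (hg : Measurable g) :
    IsIIDPair (fun n ω => f (ξ n ω, η n ω)) (fun n ω => g (ξ n ω, η n ω)) P where
  indep := h.indep.comp (fun _ x => (f x, g x)) (fun _ => hf.prodMk hg)
  ident n := (h.ident n).comp (hf.prodMk hg)

lemma identDistrib_fst (h : IsIIDPair ξ η P) (n : ℕ) : IdentDistrib (ξ n) (ξ 0) P P :=
  (h.ident n).comp measurable_fst

lemma identDistrib_snd (h : IsIIDPair ξ η P) (n : ℕ) : IdentDistrib (η n) (η 0) P P :=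
  (h.ident n).comp measurable_snd

lemma aemeasurable_fst (h : IsIIDPair ξ η P) (n : ℕ) : AEMeasurable (ξ n) P :=
  (h.identDistrib_fst n).aemeasurable_fst

lemma aemeasurable_snd (h : IsIIDPair ξ η P) (n : ℕ) : AEMeasurable (η n) P :=
  (h.identDistrib_snd n).aemeasurable_fst

lemma indep_fst (h : IsIIDPair ξ η P) : iIndepFun ξ P :=
  h.indep.comp (fun _ x => x.1) (fun _ => measurable_fst)

lemma aemeasurable_walk (h : IsIIDPair ξ η P) (n : ℕ) : AEMeasurable (walk ξ n) P :=
  Finset.aemeasurable_fun_sum _ fun k _ => h.aemeasurable_fst k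

lemma aemeasurable_pertWalk (h : IsIIDPair ξ η P) (n : ℕ) : AEMeasurable (pertWalk ξ η n) P :=
  (h.aemeasurable_walk n).add (h.aemeasurable_snd n)

/-- Strong law of large numbers for a functional of the pairs. -/
lemma strong_law (h : IsIIDPair ξ η P) {f : ℝ × ℝ → ℝ} (hf : Measurable f)
    (hint : Integrable (fun ω => f (ξ 0 ω, η 0 ω)) P) :
    ∀ᵐ ω ∂P, Tendsto (fun n : ℕ => (∑ k ∈ Finset.range n, f (ξ k ω, η k ω)) / n) atTop
      (𝓝 (∫ ω, f (ξ 0 ω, η 0 ω) ∂P)) := by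
  have h' := h.map hf hf
  exact strong_law_ae_real (fun n ω => f (ξ n ω, η n ω)) hint
    (fun i j hij => h'.indep_fst.indepFun hij) h'.identDistrib_fst

/-- The law of a sequence of independent copies is invariant under injective reindexing. -/
lemma identDistrib_reindex (h : IsIIDPair ξ η P) {f : ℕ → ℕ} (hf : Function.Injective f) :
    IdentDistrib (fun ω n => (ξ (f n) ω, η (f n) ω)) (fun ω n => (ξ n ω, η n ω)) P P :=
  IdentDistrib.pi (X := fun n ω => (ξ (f n) ω, η (f n) ω)) (Y := fun n ω => (ξ n ω, η n ω))
    (fun n => (h.ident (f n)).trans (h.ident n).symm) (h.indep.precomp hf) h.indep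

/-- If the walk has positive drift and the perturbations have integrable negative part, then
the perturbed walk drifts to infinity. -/
lemma tendsto_pertWalk (h : IsIIDPair ξ η P) (hξ : Integrable (ξ 0) P)
    (hμ : 0 < ∫ ω, ξ 0 ω ∂P) (hη : Integrable (fun ω => max (-η 0 ω) 0) P) :
    ∀ᵐ ω ∂P, Tendsto (fun n => pertWalk ξ η n ω) atTop atTop := by
  filter_upwards [h.strong_law measurable_fst hξ,
    h.strong_law (f := fun x => max (-x.2) 0) (by fun_prop) hη] with ω h1 h2
  set a := ∫ ω, max (-η 0 ω) 0 ∂P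
  set m := ∫ ω, ξ 0 ω ∂P
  -- The negative part of η n is A (n + 1) − A n. Both sums divided by n tend to a, so that negative
  -- part is o(n) and cannot offset the linear drift.
  let A : ℕ → ℝ := fun n => ∑ k ∈ Finset.range n, max (-η k ω) 0
  have hA : Tendsto (fun n : ℕ => A n / n) atTop (𝓝 a) := h2
  have hA' : Tendsto (fun n : ℕ => A (n + 1) / n) atTop (𝓝 a) := by
    have h3 : Tendsto (fun n : ℕ => A (n + 1) / (n + 1 : ℕ)) atTop (𝓝 a) :=
      hA.comp (tendsto_add_atTop_nat 1)
    have h4 : Tendsto (fun n : ℕ => (1 : ℝ) + 1 / n) atTop (𝓝 (1 + 0)) :=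
      tendsto_const_nhds.add tendsto_one_div_atTop_nhds_zero_nat
    have h5 := h3.mul h4
    rw [add_zero, mul_one] at h5
    refine h5.congr' ?_
    filter_upwards [eventually_gt_atTop 0] with n hn
    have : (0 : ℝ) < n := by exact_mod_cast hn
    push_cast
    field_simp
  have h6 : Tendsto (fun n : ℕ => (walk ξ n ω / n + A n / n - A (n + 1) / n) * n) atTop atTop := by
    refine Tendsto.pos_mul_atTop (C := m + a - a) (by simpa using hμ) ?_
      tendsto_natCast_atTop_atTop
    exact (h1.add hA).sub hA'
  refine tendsto_atTop_mono' _ ?_ h6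
  filter_upwards [eventually_gt_atTop 0] with n hn
  have : (0 : ℝ) < n := by exact_mod_cast hn
  have hs : A (n + 1) = A n + max (-η n ω) 0 := Finset.sum_range_succ _ _
  have : (walk ξ n ω / n + A n / n - A (n + 1) / n) * n = walk ξ n ω - max (-η n ω) 0 := by
    rw [hs]; field_simp; ring
  rw [this, pertWalk]
  have := le_max_left (-η n ω) 0
  linarith

/-- The perturbed walk with positive drift is unlikely ever to be very low. -/
lemma tendsto_measure_pertWalk_le [IsProbabilityMeasure P] (h : IsIIDPair ξ η P)
    (hξ : Integrable (ξ 0) P)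
    (hμ : 0 < ∫ ω, ξ 0 ω ∂P) (hη : Integrable (fun ω => max (-η 0 ω) 0) P) :
    Tendsto (fun a : ℝ => P {ω | ∃ n, pertWalk ξ η n ω ≤ -a}) atTop (𝓝 0) := by
  have hlim := tendsto_measure_iInter_atTop (μ := P)
    (s := fun a : ℝ => {ω | ∃ n, pertWalk ξ η n ω ≤ -a}) (fun a => ?_) ?_
    ⟨0, measure_ne_top _ _⟩
  · suffices H : P (⋂ a : ℝ, {ω | ∃ n, pertWalk ξ η n ω ≤ -a}) = 0 by
      rw [H] at hlim
      exact hlim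
    -- A path tending to infinity is bounded below, hence leaves the decreasing events.
    rw [measure_eq_zero_iff_ae_notMem]
    filter_upwards [h.tendsto_pertWalk hξ hμ hη] with ω hω
    have hb := bddBelow_range_of_tendsto_atTop_atTop hω
    obtain ⟨b, hb⟩ := hb
    simp only [Set.mem_iInter, Set.mem_ofPred_eq, not_forall, not_exists, not_le]
    refine ⟨-b + 1, fun n => ?_⟩
    have := hb (Set.mem_range_self n)
    linarith
  · have : {ω | ∃ n, pertWalk ξ η n ω ≤ -a} = ⋃ n, {ω | pertWalk ξ η n ω ≤ -a} := by
      ext; simp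
    rw [this]
    exact NullMeasurableSet.iUnion fun n =>
      nullMeasurableSet_le (h.aemeasurable_pertWalk n) aemeasurable_const
  · rintro a b hab ω ⟨n, hn⟩
    exact ⟨n, hn.trans (neg_le_neg hab)⟩

/-- The first walk read along an injective reindexing has the same law. -/
lemma measure_exists_reindex_le (h : IsIIDPair ξ η P) {f : ℕ → ℕ} (hf : Function.Injective f)
    (a : ℝ) :
    P {ω | ∃ n, (∑ k ∈ Finset.range n, ξ (f k) ω) + η (f n) ω ≤ a} =
      P {ω | ∃ n, pertWalk ξ η n ω ≤ a} := by
  have hs : MeasurableSet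
      {x : ℕ → ℝ × ℝ | ∃ n, (∑ k ∈ Finset.range n, (x k).1) + (x n).2 ≤ a} := by
    rw [show {x : ℕ → ℝ × ℝ | ∃ n, (∑ k ∈ Finset.range n, (x k).1) + (x n).2 ≤ a} =
      ⋃ n, {x : ℕ → ℝ × ℝ | (∑ k ∈ Finset.range n, (x k).1) + (x n).2 ≤ a} by ext; simp]
    exact MeasurableSet.iUnion fun n => measurableSet_le (by fun_prop) measurable_const
  exact (h.identDistrib_reindex hf).measure_mem_eq hs

end IsIIDPair

/-! ### Comparison of random variables through level crossings -/

/-- A fixed random variable is unlikely to exceed a diverging level, uniformly over copies. -/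
lemma tendsto_measure_ge_of_identDistrib [IsProbabilityMeasure P] {ι : Type*} {l : Filter ι}
    {X : ι → Ω → ℝ} {Y : Ω → ℝ} (hX : ∀ i, IdentDistrib (X i) Y P P) {a : ι → ℝ}
    (ha : Tendsto a l atTop) : Tendsto (fun i => P {ω | a i ≤ X i ω}) l (𝓝 0) := by
  by_cases hι : Nonempty ι
  swap
  · have := not_nonempty_iff.1 hι
    simp [Filter.filter_eq_bot_of_isEmpty l]
  obtain ⟨i₀⟩ := hι
  have hY : AEMeasurable Y P := (hX i₀).aemeasurable_snd
  have key : Tendsto (fun b : ℝ => P {ω | b ≤ Y ω}) atTop (𝓝 0) := by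
    have hlim := tendsto_measure_iInter_atTop (μ := P) (s := fun b : ℝ => {ω | b ≤ Y ω})
      (fun b => nullMeasurableSet_le aemeasurable_const hY)
      (fun a b hab ω hω => le_trans hab hω) ⟨0, measure_ne_top _ _⟩
    rw [show (⋂ b : ℝ, {ω | b ≤ Y ω}) = ∅ from Set.eq_empty_of_forall_notMem fun ω hω => by
      have : Y ω + 1 ≤ Y ω := Set.mem_iInter.1 hω (Y ω + 1)
      linarith, measure_empty] at hlim
    exact hlim
  refine (key.comp ha).congr fun i => ?_
  exact ((hX i).measure_mem_eq (s := Set.Ici (a i)) measurableSet_Ici).symm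

/-- If `A` and `Z` cross no level `x` with a gap, and `Z` is tight, then `A - Z → 0` in
probability. -/
lemma tendstoInMeasure_sub_of_crossing {ι : Type*} {l : Filter ι} {A Z : ι → Ω → ℝ}
    (htight : ∀ δ : ℝ≥0∞, 0 < δ → ∃ K : ℝ, ∀ᶠ i in l, P {ω | K ≤ |Z i ω|} ≤ δ)
    (hA : ∀ x ε : ℝ, 0 < ε → Tendsto (fun i => P {ω | x < A i ω ∧ ε < x - Z i ω}) l (𝓝 0))
    (hZ : ∀ x ε : ℝ, 0 < ε → Tendsto (fun i => P {ω | A i ω ≤ x ∧ ε < Z i ω - x}) l (𝓝 0)) :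
    TendstoInMeasure P (fun i ω => A i ω - Z i ω) l 0 := by
  rw [tendstoInMeasure_iff_norm]
  intro ε hε
  rw [ENNReal.tendsto_nhds_zero]
  intro δ hδ
  obtain ⟨K, hK⟩ := htight (δ / 2) (ENNReal.half_pos hδ.ne')
  -- Grid of mesh ε/4: if |A − Z| ≥ ε and Z lies in the cell starting at q e, then the level (q − 1)
  -- e or (q + 2) e separates A from Z, at distance more than e/2 from Z. For |Z| < K only levels
  -- with index in [−J, J] occur.
  set e := ε / 4 with he
  have he0 : 0 < e := by positivity
  obtain ⟨J, hJ⟩ := exists_nat_gt (K / e + 3)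
  let G : Finset ℤ := Finset.Icc (-(J : ℤ)) J
  have hsum : Tendsto (fun i => ∑ j ∈ G, (P {ω | (j : ℝ) * e < A i ω ∧ e / 2 < j * e - Z i ω} +
      P {ω | A i ω ≤ (j : ℝ) * e ∧ e / 2 < Z i ω - j * e})) l (𝓝 0) := by
    rw [show (0 : ℝ≥0∞) = ∑ j ∈ G, (0 + 0) by simp]
    exact tendsto_finsetSum _ fun j _ => (hA _ _ (by positivity)).add (hZ _ _ (by positivity))
  filter_upwards [hK, (ENNReal.tendsto_nhds_zero.1 hsum) (δ / 2) (ENNReal.half_pos hδ.ne')]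
    with i h1 h2
  rw [← ENNReal.add_halves δ]
  refine le_trans ?_ (add_le_add h1 h2)
  have hsub : {ω | ε ≤ ‖A i ω - Z i ω - (0 : Ω → ℝ) ω‖} ⊆ {ω | K ≤ |Z i ω|} ∪
      ⋃ j ∈ G, ({ω | (j : ℝ) * e < A i ω ∧ e / 2 < j * e - Z i ω} ∪
        {ω | A i ω ≤ (j : ℝ) * e ∧ e / 2 < Z i ω - j * e}) := by
    intro ω hω
    simp only [Pi.zero_apply, sub_zero, Real.norm_eq_abs, Set.mem_ofPred_eq] at hω
    by_cases hz : K ≤ |Z i ω|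
    · exact Or.inl hz
    right
    rw [not_le, abs_lt] at hz
    have hf1 := Int.floor_le (Z i ω / e)
    have hf2 := Int.lt_floor_add_one (Z i ω / e)
    set q := ⌊Z i ω / e⌋
    rw [le_div_iff₀ he0] at hf1
    rw [div_lt_iff₀ he0] at hf2
    have hJ' : K + 3 * e < J * e := by
      have := mul_lt_mul_of_pos_right hJ he0
      rwa [add_mul, div_mul_cancel₀ _ he0.ne'] at this
    have hq1 : (-(J : ℝ)) + 2 < q := by
      by_contra hcon
      push Not at hcon
      have := mul_le_mul_of_nonneg_right hcon he0.le
      nlinarith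
    have hq2 : (q : ℝ) < J - 2 := by
      by_contra hcon
      push Not at hcon
      have := mul_le_mul_of_nonneg_right hcon he0.le
      nlinarith
    have hq1' : -(J : ℤ) + 2 < q := by exact_mod_cast hq1
    have hq2' : q < (J : ℤ) - 2 := by exact_mod_cast hq2
    simp only [Set.mem_iUnion]
    rcases le_abs'.1 hω with h | h
    · refine ⟨q - 1, Finset.mem_Icc.2 ⟨by omega, by omega⟩, Or.inr ⟨?_, ?_⟩⟩ <;> push_cast <;>
        nlinarith
    · refine ⟨q + 2, Finset.mem_Icc.2 ⟨by omega, by omega⟩, Or.inl ⟨?_, ?_⟩⟩ <;> push_cast <;>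
        nlinarith
  refine (measure_mono hsub).trans ((measure_union_le _ _).trans ?_)
  gcongr
  exact (measure_biUnion_finset_le _ _).trans (Finset.sum_le_sum fun j _ => measure_union_le _ _)

namespace IsIIDPair

lemma memLp_fst (h : IsIIDPair ξ η P) (hL2 : MemLp (ξ 0) 2 P) (n : ℕ) : MemLp (ξ n) 2 P :=
  (h.identDistrib_fst n).memLp_iff.2 hL2

/-- Chebyshev's inequality for the increments of the walk. -/
lemma measure_walk_sub_walk_le [IsProbabilityMeasure P] (h : IsIIDPair ξ η P)
    (hL2 : MemLp (ξ 0) 2 P) {μ : ℝ} (hμ : μ = ∫ ω, ξ 0 ω ∂P) (m n : ℕ) {c : ℝ} (hc : 0 < c) :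
    P {ω | c ≤ |(walk ξ n ω - μ * n) - (walk ξ m ω - μ * m)|} ≤
      ENNReal.ofReal (variance (ξ 0) P * |(n : ℝ) - m| / c ^ 2) := by
  wlog hmn : m ≤ n generalizing m n
  · have := this n m (le_of_not_ge hmn)
    rw [abs_sub_comm (n : ℝ) m]
    convert this using 5
    exact abs_sub_comm _ _
  have hX : MemLp (∑ k ∈ Finset.Ico m n, ξ k) 2 P := memLp_finsetSum' _ fun k _ => h.memLp_fst hL2 k
  have hvar : variance (∑ k ∈ Finset.Ico m n, ξ k) P = variance (ξ 0) P * ((n : ℝ) - m) := by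
    rw [IndepFun.variance_sum (fun k _ => h.memLp_fst hL2 k)
      (fun i _ j _ hij => h.indep_fst.indepFun hij),
      Finset.sum_congr rfl fun k _ => (h.identDistrib_fst k).variance_eq]
    simp [Nat.cast_sub hmn, mul_comm]
  have hmean : ∫ ω, (∑ k ∈ Finset.Ico m n, ξ k) ω ∂P = μ * ((n : ℝ) - m) := by
    simp only [Finset.sum_apply]
    rw [integral_finsetSum _ fun k _ => (h.memLp_fst hL2 k).integrable one_le_two,
      Finset.sum_congr rfl fun k _ => (h.identDistrib_fst k).integral_eq, ← hμ]
    simp [Nat.cast_sub hmn, mul_comm]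
  have := meas_ge_le_variance_div_sq hX hc
  rw [hvar, hmean] at this
  rw [abs_of_nonneg (sub_nonneg.2 (Nat.cast_le.2 hmn))]
  refine le_trans (le_of_eq ?_) this
  congr 1
  ext ω
  have : walk ξ n ω = walk ξ m ω + ∑ k ∈ Finset.Ico m n, ξ k ω :=
    (Finset.sum_range_add_sum_Ico _ hmn).symm
  simp only [Set.mem_ofPred_eq, Finset.sum_apply, this]
  ring_nf

end IsIIDPair

/-! ### Fluctuations of the walk near time t/μ -/

/-- The fluctuation of the walk at time `t / μ`, in the spatial scale `μ √t`. -/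
noncomputable def fluct (μ : ℝ) (ξ : ℕ → Ω → ℝ) (t : ℝ) (ω : Ω) : ℝ :=
  -(walk ξ ⌊t / μ⌋₊ ω - μ * ⌊t / μ⌋₊) / (μ * √t)

/-- The time `t / μ + x √t`. -/
noncomputable def levelTime (μ x t : ℝ) : ℕ := ⌊t / μ + x * √t⌋₊

/-- The linear term wins even for negative x, so the natural floor in `levelTime` is eventually not
truncated at zero. -/
lemma tendsto_levelTime_aux {μ : ℝ} (hμ : 0 < μ) (x : ℝ) :
    Tendsto (fun t : ℝ => t / μ + x * √t) atTop atTop := by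
  have h1 : Tendsto (fun t : ℝ => √t * (√t * μ⁻¹ + x)) atTop atTop :=
    Real.tendsto_sqrt_atTop.atTop_mul_atTop₀
      (tendsto_atTop_add_const_right _ _ (Real.tendsto_sqrt_atTop.atTop_mul_const (by positivity)))
  refine h1.congr' ?_
  filter_upwards [eventually_ge_atTop 0] with t ht
  have := Real.mul_self_sqrt ht
  rw [mul_add, ← mul_assoc, this]
  ring

lemma tendsto_levelTime {μ : ℝ} (hμ : 0 < μ) (x : ℝ) :
    Tendsto (levelTime μ x) atTop atTop :=
  tendsto_nat_floor_atTop.comp (tendsto_levelTime_aux hμ x)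

namespace IsIIDPair

variable [IsProbabilityMeasure P] {μ : ℝ}

/-- The position of the walk at the time `t / μ + x √t` is `t + μ √t (x - Z) + o(√t)`, where `Z`
is the normalized fluctuation at time `t / μ`. -/
lemma tendsto_walk_levelTime (h : IsIIDPair ξ η P) (hL2 : MemLp (ξ 0) 2 P)
    (hμ : μ = ∫ ω, ξ 0 ω ∂P) (hμ0 : 0 < μ) (x : ℝ) {δ : ℝ} (hδ : 0 < δ) :
    Tendsto (fun t => P {ω | δ * √t ≤
      |walk ξ (levelTime μ x t) ω - t - μ * √t * (x - fluct μ ξ t ω)|}) atTop (𝓝 0) := by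
  set v := variance (ξ 0) P
  have hv : 0 ≤ v := variance_nonneg _ _
  -- At most (|x| + 1)√t increments separate the two times, so Chebyshev at distance (δ/2)√t leaves
  -- a bound of order 1/√t.
  have hlim : Tendsto (fun t : ℝ => ENNReal.ofReal
      (v * (|x| + 1) / (δ / 2) ^ 2 * (√t)⁻¹)) atTop (𝓝 0) := by
    rw [← ENNReal.ofReal_zero]
    refine ENNReal.tendsto_ofReal ?_
    have := (tendsto_inv_atTop_zero.comp Real.tendsto_sqrt_atTop).const_mul
      (v * (|x| + 1) / (δ / 2) ^ 2)
    rwa [mul_zero] at this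
  refine tendsto_of_tendsto_of_tendsto_of_le_of_le' tendsto_const_nhds hlim
    (Eventually.of_forall fun _ => zero_le) ?_
  filter_upwards [eventually_gt_atTop 0, (tendsto_levelTime_aux hμ0 x).eventually_ge_atTop 0,
    Real.tendsto_sqrt_atTop.eventually_ge_atTop 1,
    Real.tendsto_sqrt_atTop.eventually_ge_atTop (2 * μ / δ)] with t ht hlev hs1 hs2
  have hs0 : 0 < √t := by linarith
  rw [div_le_iff₀ hδ] at hs2
  set n := levelTime μ x t with hn
  set m := ⌊t / μ⌋₊ with hm
  have hn1 : (n : ℝ) ≤ t / μ + x * √t := Nat.floor_le hlev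
  have hn2 : t / μ + x * √t < n + 1 := Nat.lt_floor_add_one _
  have hm1 : (m : ℝ) ≤ t / μ := Nat.floor_le (by positivity)
  have hm2 : t / μ < m + 1 := Nat.lt_floor_add_one _
  have hdist : |(n : ℝ) - m| ≤ (|x| + 1) * √t := by
    have h1 := le_abs_self x
    have h2 := neg_abs_le x
    rw [abs_le]
    constructor <;> nlinarith
  -- Rounding the time costs at most one step of drift, which `hs2` bounds by (δ/2)√t.
  have hdrift : |μ * n - t - μ * √t * x| ≤ μ := by
    have e : μ * n - t - μ * √t * x = μ * (n - (t / μ + x * √t)) := by field_simp; ring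
    rw [e, abs_mul, abs_of_pos hμ0]
    have : |(n : ℝ) - (t / μ + x * √t)| ≤ 1 := by
      rw [abs_le]; constructor <;> linarith
    nlinarith
  have hfl (ω : Ω) : μ * √t * fluct μ ξ t ω = -(walk ξ m ω - μ * m) := by
    rw [fluct, ← hm]; field_simp
  refine (measure_mono (t := {ω | δ / 2 * √t ≤
    |(walk ξ n ω - μ * n) - (walk ξ m ω - μ * m)|}) fun ω hω => ?_).trans
    ((h.measure_walk_sub_walk_le hL2 hμ m n (by positivity)).trans ?_)
  · simp only [Set.mem_ofPred_eq] at hω ⊢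
    have e : walk ξ n ω - t - μ * √t * (x - fluct μ ξ t ω) =
        ((walk ξ n ω - μ * n) - (walk ξ m ω - μ * m)) + (μ * n - t - μ * √t * x) := by
      linear_combination hfl ω
    rw [e] at hω
    have := abs_add_le ((walk ξ n ω - μ * n) - (walk ξ m ω - μ * m)) (μ * n - t - μ * √t * x)
    linarith
  · refine ENNReal.ofReal_le_ofReal ?_
    calc v * |(n : ℝ) - m| / (δ / 2 * √t) ^ 2 ≤ v * ((|x| + 1) * √t) / (δ / 2 * √t) ^ 2 := by
          gcongr
      _ = _ := by field_simp

/-- The normalized fluctuations are tight. -/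
lemma tight_fluct (h : IsIIDPair ξ η P) (hL2 : MemLp (ξ 0) 2 P)
    (hμ : μ = ∫ ω, ξ 0 ω ∂P) (hμ0 : 0 < μ) (δ : ℝ≥0∞) (hδ : 0 < δ) :
    ∃ K : ℝ, ∀ᶠ t in atTop, P {ω | K ≤ |fluct μ ξ t ω|} ≤ δ := by
  set v := variance (ξ 0) P
  have hv : 0 ≤ v := variance_nonneg _ _
  have hlim : Tendsto (fun K : ℝ => ENNReal.ofReal (v / μ ^ 3 * (K ^ 2)⁻¹)) atTop (𝓝 0) := by
    rw [← ENNReal.ofReal_zero]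
    refine ENNReal.tendsto_ofReal ?_
    have := (tendsto_inv_atTop_zero.comp (tendsto_pow_atTop (α := ℝ) two_ne_zero)).const_mul
      (v / μ ^ 3)
    rwa [mul_zero] at this
  obtain ⟨K, hK, hK0⟩ := ((ENNReal.tendsto_nhds_zero.1 hlim δ hδ).and
    (eventually_gt_atTop 0)).exists
  refine ⟨K, ?_⟩
  filter_upwards [eventually_gt_atTop 0] with t ht
  have hs0 : 0 < √t := Real.sqrt_pos.2 ht
  have hm1 : (⌊t / μ⌋₊ : ℝ) ≤ t / μ := Nat.floor_le (by positivity)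
  refine le_trans ((measure_mono (t := {ω | K * (μ * √t) ≤
    |(walk ξ ⌊t / μ⌋₊ ω - μ * ⌊t / μ⌋₊) - (walk ξ 0 ω - μ * (0 : ℕ))|}) fun ω hω => ?_).trans
    (h.measure_walk_sub_walk_le hL2 hμ 0 _ (by positivity))) (le_trans ?_ hK)
  · simp only [Set.mem_ofPred_eq, fluct] at hω
    rw [abs_div, abs_neg, abs_of_pos (by positivity : 0 < μ * √t),
      le_div_iff₀ (by positivity)] at hω
    simpa [walk] using hω
  · refine ENNReal.ofReal_le_ofReal ?_
    have : (K * (μ * √t)) ^ 2 = K ^ 2 * μ ^ 2 * t := by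
      rw [mul_pow, mul_pow, Real.sq_sqrt ht.le]; ring
    rw [this, Nat.cast_zero, sub_zero, abs_of_nonneg (Nat.cast_nonneg _)]
    calc v * (⌊t / μ⌋₊ : ℝ) / (K ^ 2 * μ ^ 2 * t) ≤ v * (t / μ) / (K ^ 2 * μ ^ 2 * t) := by gcongr
      _ = _ := by field_simp

/-- A process `A t` of random times which crosses each level as the walk does is, in the scale
`√t`, asymptotically equal to the fluctuation of the walk. -/
lemma tendstoInMeasure_sub_fluct (h : IsIIDPair ξ η P) (hL2 : MemLp (ξ 0) 2 P)
    (hμ : μ = ∫ ω, ξ 0 ω ∂P) (hμ0 : 0 < μ) {A : ℝ → Ω → ℕ}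
    (hup : ∀ x c : ℝ, 0 < c → Tendsto (fun t => P {ω | levelTime μ x t < A t ω ∧
      c * √t ≤ walk ξ (levelTime μ x t) ω - t}) atTop (𝓝 0))
    (hdown : ∀ x c : ℝ, 0 < c → Tendsto (fun t => P {ω | A t ω ≤ levelTime μ x t ∧
      c * √t ≤ t - walk ξ (levelTime μ x t) ω}) atTop (𝓝 0)) :
    TendstoInMeasure P (fun t ω => (A t ω - t / μ) / √t - fluct μ ξ t ω) atTop 0 := by
  refine tendstoInMeasure_sub_of_crossing (h.tight_fluct hL2 hμ hμ0) (fun x ε hε => ?_)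
    (fun x ε hε => ?_)
  -- A gap ε in the normalized time is a gap με√t in space. Half of it absorbs the approximation
  -- error, half is left for the crossing hypothesis.
  · have hlim := (hup x (μ * ε / 2) (by positivity)).add
      (h.tendsto_walk_levelTime hL2 hμ hμ0 x (δ := μ * ε / 2) (by positivity))
    rw [add_zero] at hlim
    refine tendsto_of_tendsto_of_tendsto_of_le_of_le' tendsto_const_nhds hlim
      (Eventually.of_forall fun _ => zero_le) ?_
    filter_upwards [eventually_gt_atTop 0,
      (tendsto_levelTime_aux hμ0 x).eventually_ge_atTop 0] with t ht hlev
    have hs0 : 0 < √t := Real.sqrt_pos.2 ht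
    refine (measure_mono ?_).trans (measure_union_le _ _)
    rintro ω ⟨h1, h2⟩
    rw [lt_div_iff₀ hs0] at h1
    have h3 : levelTime μ x t < A t ω := (Nat.floor_lt hlev).2 (by linarith)
    by_cases h4 : μ * ε / 2 * √t ≤ |walk ξ (levelTime μ x t) ω - t - μ * √t * (x - fluct μ ξ t ω)|
    · exact Or.inr h4
    · refine Or.inl ⟨h3, ?_⟩
      rw [not_le, abs_lt] at h4
      have := mul_lt_mul_of_pos_left h2 (by positivity : 0 < μ * √t)
      linarith
  · have hlim := (hdown x (μ * ε / 2) (by positivity)).add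
      (h.tendsto_walk_levelTime hL2 hμ hμ0 x (δ := μ * ε / 2) (by positivity))
    rw [add_zero] at hlim
    refine tendsto_of_tendsto_of_tendsto_of_le_of_le' tendsto_const_nhds hlim
      (Eventually.of_forall fun _ => zero_le) ?_
    filter_upwards [eventually_gt_atTop 0] with t ht
    have hs0 : 0 < √t := Real.sqrt_pos.2 ht
    refine (measure_mono ?_).trans (measure_union_le _ _)
    rintro ω ⟨h1, h2⟩
    rw [div_le_iff₀ hs0] at h1
    have h3 : A t ω ≤ levelTime μ x t := Nat.le_floor (by linarith)
    by_cases h4 : μ * ε / 2 * √t ≤ |walk ξ (levelTime μ x t) ω - t - μ * √t * (x - fluct μ ξ t ω)|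
    · exact Or.inr h4
    · refine Or.inl ⟨h3, ?_⟩
      rw [not_le, abs_lt] at h4
      have := mul_lt_mul_of_pos_left h2 (by positivity : 0 < μ * √t)
      linarith

end IsIIDPair

end RandomWalk

/-! ### Pathwise properties of the counting processes -/

section CountingProcesses

variable {Ω : Type*} {ξ η : ℕ → Ω → ℝ} {t : ℝ} {ω : Ω}

section Pathwise

/-- Index k carries T_{k+1}, so the indices k < n cover T_1, …, T_n. Since `toNat` sends `⊤` to 0, a
strict lower bound on `toNat` already excludes infinite values, whereas upper bounds below need
finiteness as a hypothesis. -/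
lemma pertWalk_le_of_lt_tau {n k : ℕ} (h : n < (tau ξ η t ω).toNat) (hk : k < n) :
    pertWalk ξ η k ω ≤ t := by
  by_contra! hcon
  have h1 : tau ξ η t ω ≤ ((k + 1 : ℕ) : ℕ∞) := iInf₂_le k hcon
  have := ENat.toNat_le_of_le_natCast h1
  omega

lemma exists_lt_pertWalk_of_tau_le {n : ℕ} (hfin : tau ξ η t ω ≠ ⊤)
    (h : (tau ξ η t ω).toNat ≤ n) : ∃ k < n, t < pertWalk ξ η k ω := by
  by_contra! hcon
  have h1 : ((n + 1 : ℕ) : ℕ∞) ≤ tau ξ η t ω := le_iInf₂ fun k hk => by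
    have : n ≤ k := by
      by_contra! hkn
      exact absurd hk (not_lt.2 (hcon k hkn))
    exact_mod_cast Nat.succ_le_succ this
  rw [← ENat.natCast_toNat hfin] at h1
  have : n + 1 ≤ (tau ξ η t ω).toNat := by exact_mod_cast h1
  omega

lemma tau_ne_top {k : ℕ} (h : t < pertWalk ξ η k ω) : tau ξ η t ω ≠ ⊤ :=
  ne_top_of_le_ne_top (ENat.natCast_ne_top (k + 1)) (iInf₂_le k h)

lemma rho_le {n : ℕ} (h : ∀ k ≥ n, t < pertWalk ξ η k ω) : rho ξ η t ω ≤ (n : ℕ∞) :=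
  iSup₂_le fun k hk => by
    have : k < n := by
      by_contra! hkn
      exact absurd (h k hkn) (not_lt.2 hk)
    exact_mod_cast this

lemma exists_pertWalk_le_of_lt_rho {n : ℕ} (h : n < (rho ξ η t ω).toNat) :
    ∃ k ≥ n, pertWalk ξ η k ω ≤ t := by
  by_contra! hcon
  have := ENat.toNat_le_of_le_natCast (rho_le hcon)
  omega

lemma lt_pertWalk_of_rho_le {n k : ℕ} (hfin : rho ξ η t ω ≠ ⊤) (h : (rho ξ η t ω).toNat ≤ n)
    (hk : n ≤ k) : t < pertWalk ξ η k ω := by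
  by_contra! hcon
  have h1 : ((k + 1 : ℕ) : ℕ∞) ≤ rho ξ η t ω :=
    le_iSup₂ (f := fun (n : ℕ) (_ : pertWalk ξ η n ω ≤ t) => ((n + 1 : ℕ) : ℕ∞)) k hcon
  rw [← ENat.natCast_toNat hfin] at h1
  have : k + 1 ≤ (rho ξ η t ω).toNat := by exact_mod_cast h1
  omega

lemma visits_le_rho (hfin : rho ξ η t ω ≠ ⊤) : visits ξ η t ω ≤ ((rho ξ η t ω).toNat : ℕ∞) := by
  have hsub : {n : ℕ | pertWalk ξ η n ω ≤ t} ⊆ Finset.range (rho ξ η t ω).toNat := by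
    intro k hk
    rw [Finset.coe_range, Set.mem_Iio]
    by_contra! hcon
    exact absurd (lt_pertWalk_of_rho_le hfin le_rfl hcon) (not_lt.2 hk)
  refine (Set.encard_le_encard hsub).trans ?_
  rw [Set.encard_coe_eq_coe_finsetCard, Finset.card_range]

lemma visits_ne_top (hfin : rho ξ η t ω ≠ ⊤) : visits ξ η t ω ≠ ⊤ :=
  ne_top_of_le_ne_top (ENat.natCast_ne_top _) (visits_le_rho hfin)

lemma visits_toNat_le_rho (hfin : rho ξ η t ω ≠ ⊤) :
    (visits ξ η t ω).toNat ≤ (rho ξ η t ω).toNat :=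
  ENat.toNat_le_of_le_natCast (visits_le_rho hfin)

/-- All τ − 1 indices before first passage are visits. This is the lower half of the squeeze;
`visits_le_rho` is the upper half. -/
lemma tau_toNat_le_visits (hfin : visits ξ η t ω ≠ ⊤) :
    (tau ξ η t ω).toNat ≤ (visits ξ η t ω).toNat + 1 := by
  rcases Nat.eq_zero_or_pos (tau ξ η t ω).toNat with h | h
  · omega
  have hsub : (Finset.range ((tau ξ η t ω).toNat - 1) : Set ℕ) ⊆
      {n : ℕ | pertWalk ξ η n ω ≤ t} := by
    intro k hk
    rw [Finset.coe_range, Set.mem_Iio] at hk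
    exact pertWalk_le_of_lt_tau (n := (tau ξ η t ω).toNat - 1) (by omega) hk
  have h1 := Set.encard_le_encard hsub
  rw [Set.encard_coe_eq_coe_finsetCard, Finset.card_range] at h1
  change _ ≤ visits ξ η t ω at h1
  rw [← ENat.natCast_toNat hfin] at h1
  have : (tau ξ η t ω).toNat - 1 ≤ (visits ξ η t ω).toNat := by exact_mod_cast h1
  omega

end Pathwise

variable [MeasurableSpace Ω] {P : Measure Ω}

/-! ### Measurability, finiteness and crossing estimates -/

namespace IsIIDPair

lemma aemeasurable_tau (h : IsIIDPair ξ η P) (t : ℝ) : AEMeasurable (tau ξ η t) P := by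
  have : BorelSpace ℕ∞ := ⟨by rw [borel_eq_top_of_countable]; exact MeasurableSpace.ext (by simp)⟩
  refine AEMeasurable.iInf fun n => ?_
  have hm : Measurable fun x : ℝ => ⨅ _ : t < x, ((n + 1 : ℕ) : ℕ∞) := by
    classical
    simp_rw [iInf_eq_if]
    exact Measurable.ite measurableSet_Ioi measurable_const measurable_const
  exact hm.comp_aemeasurable (h.aemeasurable_pertWalk n)

lemma aemeasurable_rho (h : IsIIDPair ξ η P) (t : ℝ) : AEMeasurable (rho ξ η t) P := by
  have : BorelSpace ℕ∞ := ⟨by rw [borel_eq_top_of_countable]; exact MeasurableSpace.ext (by simp)⟩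
  refine AEMeasurable.iSup fun n => ?_
  have hm : Measurable fun x : ℝ => ⨆ _ : x ≤ t, ((n + 1 : ℕ) : ℕ∞) := by
    classical
    simp_rw [iSup_eq_if]
    exact Measurable.ite measurableSet_Iic measurable_const measurable_const
  exact hm.comp_aemeasurable (h.aemeasurable_pertWalk n)

/-- The count is a series of indicators in `ℝ≥0∞`, which is measurable without any convergence
condition. -/
lemma aemeasurable_visits (h : IsIIDPair ξ η P) (t : ℝ) :
    AEMeasurable (fun ω => ((visits ξ η t ω).toNat : ℝ)) P := by
  have h1 : AEMeasurable (fun ω => ∑' n, (Set.Iic t).indicator (1 : ℝ → ℝ≥0∞)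
      (pertWalk ξ η n ω)) P :=
    AEMeasurable.tsum fun n =>
      (measurable_one.indicator measurableSet_Iic).comp_aemeasurable (h.aemeasurable_pertWalk n)
  refine h1.ennreal_toReal.congr (Eventually.of_forall fun ω => ?_)
  have h2 : ((visits ξ η t ω : ℕ∞) : ℝ≥0∞) =
      ∑' n, (Set.Iic t).indicator (1 : ℝ → ℝ≥0∞) (pertWalk ξ η n ω) := by
    rw [visits, ← Measure.count_apply (MeasurableSet.of_discrete),
      ← lintegral_indicator_one (MeasurableSet.of_discrete), lintegral_count]
    rfl
  dsimp only
  rw [← h2]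
  cases hv : visits ξ η t ω <;> simp

/-- If the second component has integrable negative part, the last exit times are finite. -/
lemma ae_rho_ne_top (h : IsIIDPair ξ η P) (hξ : Integrable (ξ 0) P)
    (hμ : 0 < ∫ ω, ξ 0 ω ∂P) (hη : Integrable (fun ω => max (-η 0 ω) 0) P) :
    ∀ᵐ ω ∂P, ∀ t : ℝ, rho ξ η t ω ≠ ⊤ := by
  filter_upwards [h.tendsto_pertWalk hξ hμ hη] with ω hω t
  obtain ⟨N, hN⟩ := eventually_atTop.1 (hω.eventually_gt_atTop t)
  exact ne_top_of_le_ne_top (ENat.natCast_ne_top N) (rho_le hN)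

variable [IsProbabilityMeasure P] {μ : ℝ}

/-- The first passage times are finite, without any condition on the second component. -/
lemma ae_tau_ne_top (h : IsIIDPair ξ η P) (hL2 : MemLp (ξ 0) 2 P)
    (hμ : μ = ∫ ω, ξ 0 ω ∂P) (hμ0 : 0 < μ) : ∀ᵐ ω ∂P, ∀ t : ℝ, tau ξ η t ω ≠ ⊤ := by
  -- If the perturbed walk never exceeds N, then for every n either S_n ≤ μn/2 or −η n ≥ μn/2 − N.
  -- Both probabilities vanish as n grows, the second because the law of η n does not depend on n.
  have key (N : ℕ) : ∀ᵐ ω ∂P, ∃ n, (N : ℝ) < pertWalk ξ η n ω := by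
    have hlin : Tendsto (fun n : ℕ => μ / 2 * n - N) atTop atTop :=
      tendsto_atTop_add_const_right _ _
        (tendsto_natCast_atTop_atTop.const_mul_atTop (by positivity))
    have h1 : Tendsto (fun n : ℕ => P {ω | μ / 2 * n - N ≤ -η n ω}) atTop (𝓝 0) :=
      tendsto_measure_ge_of_identDistrib (X := fun n ω => -η n ω)
        (fun n => (h.identDistrib_snd n).comp measurable_neg) hlin
    have h2 : Tendsto (fun n : ℕ => ENNReal.ofReal
        (variance (ξ 0) P * |(n : ℝ) - (0 : ℕ)| / (μ / 2 * n) ^ 2)) atTop (𝓝 0) := by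
      rw [← ENNReal.ofReal_zero]
      refine ENNReal.tendsto_ofReal ?_
      have := tendsto_inv_atTop_nhds_zero_nat (𝕜 := ℝ) |>.const_mul
        (variance (ξ 0) P / (μ / 2) ^ 2)
      rw [mul_zero] at this
      refine this.congr' ?_
      filter_upwards [eventually_gt_atTop 0] with n hn
      have : (0 : ℝ) < n := by exact_mod_cast hn
      rw [Nat.cast_zero, sub_zero, abs_of_pos this]
      field_simp
    rw [ae_iff]
    have h3 := h1.add h2
    rw [add_zero] at h3
    refine le_antisymm (ge_of_tendsto h3 ?_) zero_le
    filter_upwards [eventually_gt_atTop 0] with n hn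
    have hn0 : (0 : ℝ) < n := by exact_mod_cast hn
    refine le_trans ?_ (add_le_add_right
      (h.measure_walk_sub_walk_le hL2 hμ 0 n (c := μ / 2 * n) (by positivity)) _)
    refine (measure_mono fun ω hω => ?_).trans (measure_union_le _ _)
    simp only [not_exists, not_lt, Set.mem_ofPred_eq] at hω
    have := hω n
    rw [pertWalk] at this
    rcases le_total (walk ξ n ω) (μ / 2 * n) with hw | hw
    · right
      simp only [walk, Finset.range_zero, Finset.sum_empty, Nat.cast_zero, mul_zero, sub_zero,
        Set.mem_ofPred_eq]
      rw [abs_sub_comm]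
      refine le_trans ?_ (le_abs_self _)
      change walk ξ n ω ≤ μ / 2 * n at hw
      rw [walk] at hw
      linarith
    · left
      simp only [Set.mem_ofPred_eq]
      linarith
  filter_upwards [ae_all_iff.2 key] with ω hω t
  obtain ⟨N, hN⟩ := exists_nat_ge t
  obtain ⟨n, hn⟩ := hω N
  exact tau_ne_top (hN.trans_lt hn)

/-- In the scale `√t`, the last exit time follows the fluctuation of the walk. -/
lemma tendstoInMeasure_rho (h : IsIIDPair ξ η P) (hL2 : MemLp (ξ 0) 2 P)
    (hμ : μ = ∫ ω, ξ 0 ω ∂P) (hμ0 : 0 < μ) (hη : Integrable (fun ω => max (-η 0 ω) 0) P) :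
    TendstoInMeasure P
      (fun t ω => (((rho ξ η t ω).toNat : ℝ) - t / μ) / √t - fluct μ ξ t ω) atTop 0 := by
  have hξ : Integrable (ξ 0) P := hL2.integrable one_le_two
  have hmean : 0 < ∫ ω, ξ 0 ω ∂P := hμ ▸ hμ0
  refine h.tendstoInMeasure_sub_fluct hL2 hμ hμ0 (A := fun t ω => (rho ξ η t ω).toNat)
    (fun x c hc => ?_) (fun x c hc => ?_)
  · have hlim := (h.tendsto_measure_pertWalk_le hξ hmean hη).comp
      (Real.tendsto_sqrt_atTop.const_mul_atTop hc)
    refine tendsto_of_tendsto_of_tendsto_of_le_of_le tendsto_const_nhds hlim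
      (fun _ => zero_le) fun t => ?_
    -- Shifting the indices by the level time restarts the walk there without changing its law.
    rw [Function.comp_apply, ← h.measure_exists_reindex_le (add_right_injective (levelTime μ x t))]
    refine measure_mono fun ω hω => ?_
    obtain ⟨k, hk, hkt⟩ := exists_pertWalk_le_of_lt_rho hω.1
    obtain ⟨j, rfl⟩ := Nat.exists_eq_add_of_le hk
    refine ⟨j, ?_⟩
    have hw : walk ξ (levelTime μ x t + j) ω = walk ξ (levelTime μ x t) ω +
        ∑ i ∈ Finset.range j, ξ (levelTime μ x t + i) ω := Finset.sum_range_add _ _ _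
    rw [pertWalk, hw] at hkt
    have := hω.2
    linarith
  · have hlim := tendsto_measure_ge_of_identDistrib (P := P)
      (X := fun t => η (levelTime μ x t)) (fun t => h.identDistrib_snd _)
      (Real.tendsto_sqrt_atTop.const_mul_atTop hc)
    refine tendsto_of_tendsto_of_tendsto_of_le_of_le tendsto_const_nhds hlim
      (fun _ => zero_le) fun t => measure_mono_ae ?_
    filter_upwards [h.ae_rho_ne_top hξ hmean hη] with ω hfin hω
    have := lt_pertWalk_of_rho_le (hfin t) hω.1 le_rfl
    rw [pertWalk] at this
    have := hω.2
    change c * √t ≤ η (levelTime μ x t) ω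
    linarith

/-- In the scale `√t`, the first passage time follows the fluctuation of the walk. -/
lemma tendstoInMeasure_tau (h : IsIIDPair ξ η P) (hL2 : MemLp (ξ 0) 2 P)
    (hμ : μ = ∫ ω, ξ 0 ω ∂P) (hμ0 : 0 < μ) (hη : Integrable (fun ω => max (η 0 ω) 0) P) :
    TendstoInMeasure P
      (fun t ω => (((tau ξ η t ω).toNat : ℝ) - t / μ) / √t - fluct μ ξ t ω) atTop 0 := by
  have hξ : Integrable (ξ 0) P := hL2.integrable one_le_two
  have hmean : 0 < ∫ ω, ξ 0 ω ∂P := hμ ▸ hμ0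
  -- The difference S_n − T_{k+1} equals (ξ − η) at index k plus the increments with indices k+1, …,
  -- n−1: backwards from n, a walk perturbed by ξ − η.
  have h' : IsIIDPair ξ (fun n ω => ξ n ω - η n ω) P :=
    h.map measurable_fst (g := fun x => x.1 - x.2) (by fun_prop)
  have hη' : Integrable (fun ω => max (-(ξ 0 ω - η 0 ω)) 0) P := by
    refine (hξ.norm.add hη).mono' ?_ (Eventually.of_forall fun ω => ?_)
    · exact (((h'.aemeasurable_snd 0).neg).max aemeasurable_const).aestronglyMeasurable
    · rw [Real.norm_of_nonneg (le_max_right _ _), Pi.add_apply, Real.norm_eq_abs]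
      have h1 := neg_abs_le (ξ 0 ω)
      have h2 := le_max_left (η 0 ω) 0
      have h3 := le_max_right (η 0 ω) 0
      have h4 := abs_nonneg (ξ 0 ω)
      exact max_le (by linarith) (by linarith)
  refine h.tendstoInMeasure_sub_fluct hL2 hμ hμ0 (A := fun t ω => (tau ξ η t ω).toNat)
    (fun x c hc => ?_) (fun x c hc => ?_)
  · have hlim := tendsto_measure_ge_of_identDistrib (P := P)
      (X := fun t ω => ξ (levelTime μ x t - 1) ω - η (levelTime μ x t - 1) ω)
      (fun t => h'.identDistrib_snd (levelTime μ x t - 1))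
      (Real.tendsto_sqrt_atTop.const_mul_atTop hc)
    refine tendsto_of_tendsto_of_tendsto_of_le_of_le' tendsto_const_nhds hlim
      (Eventually.of_forall fun _ => zero_le) ?_
    -- A positive level time keeps the index n − 1, which carries T_n, from being truncated.
    filter_upwards [(tendsto_levelTime hμ0 x).eventually_gt_atTop 0] with t ht
    refine measure_mono fun ω hω => ?_
    obtain ⟨n, hn⟩ := Nat.exists_eq_succ_of_ne_zero ht.ne'
    obtain ⟨h1, h2⟩ := hω
    have h3 := pertWalk_le_of_lt_tau h1 (k := n) (by omega)
    have hw : walk ξ (n + 1) ω = walk ξ n ω + ξ n ω := Finset.sum_range_succ _ _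
    rw [hn, Nat.succ_eq_add_one, hw] at h2
    rw [pertWalk] at h3
    simp only [Set.mem_ofPred_eq, hn, Nat.succ_eq_add_one, Nat.add_sub_cancel]
    linarith
  · have hlim := (h'.tendsto_measure_pertWalk_le hξ hmean hη').comp
      (Real.tendsto_sqrt_atTop.const_mul_atTop hc)
    refine tendsto_of_tendsto_of_tendsto_of_le_of_le tendsto_const_nhds hlim
      (fun _ => zero_le) fun t => ?_
    set n := levelTime μ x t
    -- Time reversal of the first n indices, extended by the identity to stay injective.
    let f : ℕ → ℕ := fun i => if i < n then n - 1 - i else i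
    have hf : Function.Injective f := by
      intro i j hij
      simp only [f] at hij
      split_ifs at hij <;> omega
    rw [Function.comp_apply, ← h'.measure_exists_reindex_le hf]
    refine measure_mono_ae ?_
    filter_upwards [h.ae_tau_ne_top hL2 hμ hμ0] with ω hfin hω
    obtain ⟨k, hk, hkt⟩ := exists_lt_pertWalk_of_tau_le (hfin t) hω.1
    refine ⟨n - 1 - k, ?_⟩
    have hrev (j : ℕ) (hj : j ≤ n) :
        (∑ i ∈ Finset.range j, ξ (f i) ω) + walk ξ (n - j) ω = walk ξ n ω := by
      induction j with
      | zero => simp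
      | succ j ih =>
        have e : n - j = (n - (j + 1)) + 1 := by omega
        have hw : walk ξ (n - j) ω = walk ξ (n - (j + 1)) ω + ξ (n - (j + 1)) ω := by
          rw [e]; exact Finset.sum_range_succ _ _
        have hfj : f j = n - (j + 1) := by
          simp only [f]; rw [if_pos (by omega)]; omega
        rw [Finset.sum_range_succ, hfj, ← ih (by omega), hw]
        ring
    have h1 := hrev (n - 1 - k) (by omega)
    have h2 : n - (n - 1 - k) = k + 1 := by omega
    have h3 : f (n - 1 - k) = k := by simp only [f]; rw [if_pos (by omega)]; omega
    have hw : walk ξ (k + 1) ω = walk ξ k ω + ξ k ω := Finset.sum_range_succ _ _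
    rw [h2, hw] at h1
    rw [pertWalk] at hkt
    have := hω.2
    rw [h3]
    linarith

end IsIIDPair

end CountingProcesses

/-! ### Finite-dimensional central limit theorem for partial sums -/

section PartialSums

/-- Telescoping: factors are exchanged one at a time, and the others have modulus at most 1. -/
lemma norm_prod_sub_prod_le_sum {ι : Type*} (s : Finset ι) {z w : ι → ℂ}
    (hz : ∀ i ∈ s, ‖z i‖ ≤ 1) (hw : ∀ i ∈ s, ‖w i‖ ≤ 1) :
    ‖∏ i ∈ s, z i - ∏ i ∈ s, w i‖ ≤ ∑ i ∈ s, ‖z i - w i‖ := by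
  classical
  induction s using Finset.induction_on with
  | empty => simp
  | insert a s ha ih =>
    rw [Finset.prod_insert ha, Finset.prod_insert ha, Finset.sum_insert ha]
    have hz' : ∀ i ∈ s, ‖z i‖ ≤ 1 := fun i hi => hz i (Finset.mem_insert_of_mem hi)
    have hw' : ∀ i ∈ s, ‖w i‖ ≤ 1 := fun i hi => hw i (Finset.mem_insert_of_mem hi)
    have e : z a * ∏ i ∈ s, z i - w a * ∏ i ∈ s, w i =
        (z a - w a) * ∏ i ∈ s, z i + w a * (∏ i ∈ s, z i - ∏ i ∈ s, w i) := by ring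
    rw [e]
    refine (norm_add_le _ _).trans (add_le_add ?_ ?_)
    · rw [norm_mul]
      refine mul_le_of_le_one_right (norm_nonneg _) ?_
      rw [norm_prod]
      exact Finset.prod_le_one (fun _ _ => norm_nonneg _) hz'
    · rw [norm_mul]
      exact (mul_le_of_le_one_left (norm_nonneg _) (hw a (Finset.mem_insert_self _ _))).trans
        (ih hz' hw')

/-- A product of values of a characteristic function of a standardized law at small arguments with
converging sum of squares converges to a Gaussian characteristic function. -/
lemma tendsto_prod_of_isLittleO {ι : Type*} {l : Filter ι} {φ : ℝ → ℂ} (hφ1 : ∀ t, ‖φ t‖ ≤ 1)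
    (hφ : (fun t : ℝ => φ t - (1 - (t : ℂ) ^ 2 / 2)) =o[𝓝 0] fun t : ℝ => t ^ 2)
    {s : ι → Finset ℕ} {a : ι → ℕ → ℝ} {V : ℝ}
    (hsmall : ∀ δ > 0, ∀ᶠ i in l, ∀ k ∈ s i, |a i k| < δ)
    (hsum : Tendsto (fun i => ∑ k ∈ s i, a i k ^ 2) l (𝓝 V)) :
    Tendsto (fun i => ∏ k ∈ s i, φ (a i k)) l (𝓝 (Complex.exp (-(V : ℂ) / 2))) := by
  -- The Gaussian factors multiply exactly, and each differs from φ by o(t²), so the total error is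
  -- small against the bounded sum of squares.
  let g : ℝ → ℂ := fun t => Complex.exp (-(t : ℂ) ^ 2 / 2)
  have hg1 (t : ℝ) : ‖g t‖ ≤ 1 := by
    have e : g t = Complex.exp ((-t ^ 2 / 2 : ℝ) : ℂ) := by simp [g]
    rw [e, Complex.norm_exp_ofReal]
    exact Real.exp_le_one_iff.2 (by nlinarith [sq_nonneg t])
  have hgo : (fun t : ℝ => g t - (1 - (t : ℂ) ^ 2 / 2)) =o[𝓝 0] fun t : ℝ => (t : ℂ) ^ 2 := by
    have h1 : (fun w : ℂ => Complex.exp w - 1 - w) =o[𝓝 0] fun w : ℂ => w := by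
      have := (hasDerivAt_iff_isLittleO.1 (Complex.hasDerivAt_exp 0))
      simpa [sub_sub] using this
    have h2 : Tendsto (fun t : ℝ => -(t : ℂ) ^ 2 / 2) (𝓝 0) (𝓝 0) := by
      have : Continuous fun t : ℝ => -(t : ℂ) ^ 2 / 2 := by fun_prop
      simpa using this.tendsto 0
    have h3 := h1.comp_tendsto h2
    refine (h3.congr_left fun t => ?_).trans_isBigO ?_
    · simp only [Function.comp_apply, g]; ring
    · refine Asymptotics.IsBigO.of_bound 1 (Eventually.of_forall fun t => ?_)
      simp only [Function.comp_apply, norm_div, norm_neg, one_mul]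
      have := norm_nonneg ((t : ℂ) ^ 2)
      norm_num
      positivity
  have hdiff : (fun t : ℝ => φ t - g t) =o[𝓝 0] fun t : ℝ => (t : ℂ) ^ 2 :=
    ((hφ.trans_isBigO (.of_bound 1 (by simp))).sub hgo).congr_left fun t => by ring
  have hmain : Tendsto (fun i => ∏ k ∈ s i, g (a i k)) l (𝓝 (Complex.exp (-(V : ℂ) / 2))) := by
    have hc : Continuous fun v : ℝ => Complex.exp (-(v : ℂ) / 2) := by fun_prop
    refine ((hc.tendsto V).comp hsum).congr fun i => ?_
    simp only [Function.comp_apply, g]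
    rw [← Complex.exp_sum]
    congr 1
    push_cast
    rw [← Finset.sum_neg_distrib, Finset.sum_div]
  have hzero : Tendsto (fun i => ∏ k ∈ s i, φ (a i k) - ∏ k ∈ s i, g (a i k)) l (𝓝 0) := by
    rw [Metric.tendsto_nhds]
    intro ε hε
    -- The sum of squares is eventually below |V| + 1, so this constant makes the total error at
    -- most ε/2.
    have hc : 0 < ε / (2 * (|V| + 1)) := by positivity
    obtain ⟨δ, hδ, hδ'⟩ := Metric.eventually_nhds_iff.1 (hdiff.def hc)
    filter_upwards [hsmall δ hδ, hsum.eventually_lt_const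
      (show V < |V| + 1 by linarith [le_abs_self V])] with i h1 h2
    rw [dist_zero_right]
    refine (norm_prod_sub_prod_le_sum (s i) (fun k _ => hφ1 _) (fun k _ => hg1 _)).trans_lt ?_
    calc ∑ k ∈ s i, ‖φ (a i k) - g (a i k)‖
        ≤ ∑ k ∈ s i, ε / (2 * (|V| + 1)) * a i k ^ 2 := Finset.sum_le_sum fun k hk => by
          have := hδ' (y := a i k) (by simpa using h1 k hk)
          simpa using this
      _ = ε / (2 * (|V| + 1)) * ∑ k ∈ s i, a i k ^ 2 := by rw [Finset.mul_sum]
      _ ≤ ε / (2 * (|V| + 1)) * (|V| + 1) := by gcongr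
      _ = ε / 2 := by field_simp
      _ < ε := by linarith
  simpa using hzero.add hmain

variable {Ω Ω' : Type*} [MeasurableSpace Ω] [MeasurableSpace Ω'] {P : Measure Ω} {Q : Measure Ω'}

/-- The Cramér–Wold reduction to linear combinations of the coordinates. -/
lemma charFun_map_toLp {k : ℕ} {X : Ω → Fin k → ℝ} (hX : AEMeasurable X P)
    (θ : EuclideanSpace ℝ (Fin k)) :
    charFun (P.map fun ω => WithLp.toLp 2 (X ω)) θ =
      charFun (P.map fun ω => ∑ i, θ i * X ω i) 1 := by
  have h1 : AEMeasurable (fun ω => (WithLp.toLp 2 (X ω) : EuclideanSpace ℝ (Fin k))) P :=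
    (WithLp.measurable_toLp 2 (Fin k → ℝ)).comp_aemeasurable hX
  rw [charFun_apply, charFun_apply, integral_map h1 (by fun_prop), integral_map (by fun_prop)
    (by fun_prop)]
  congr 1
  ext ω
  simp [PiLp.inner_apply]

/-- Linear combinations of the coordinates of a Brownian motion are Gaussian. -/
lemma charFun_map_sum_brownian [IsProbabilityMeasure Q] {B : ℝ≥0 → Ω' → ℝ}
    (hB : IsPreBrownianReal B Q) {k : ℕ} (u : Fin k → ℝ≥0) (θ : Fin k → ℝ) :
    charFun (Q.map fun ω => ∑ i, θ i * B (u i) ω) 1 =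
      Complex.exp (-((∑ i, ∑ j, θ i * θ j * min (u i : ℝ) (u j) : ℝ) : ℂ) / 2) := by
  have hG : IsGaussianProcess (fun (i : Fin k) ω => θ i • B (u i) ω) Q :=
    (hB.isGaussianProcess.comp_right u).smul θ
  have hlaw : HasGaussianLaw (fun ω => ∑ i, θ i * B (u i) ω) Q := hG.hasGaussianLaw_fun_sum
  have hint (i : Fin k) : Integrable (fun ω => θ i * B (u i) ω) Q :=
    (hB.integrable_eval (u i)).const_mul _
  have hL2 (i : Fin k) : MemLp (fun ω => θ i * B (u i) ω) 2 Q :=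
    (hG.hasGaussianLaw_eval i).memLp_two
  rw [hlaw.charFun_map_eq]
  simp only [RCLike.inner_apply, conj_trivial, mul_one]
  rw [integral_finsetSum _ fun i _ => hint i, variance_fun_sum hL2]
  simp only [integral_const_mul, hB.integral_eval, mul_zero, Finset.sum_const_zero,
    covariance_const_mul_left, covariance_const_mul_right]
  congr 1
  simp only [show ∀ i j, cov[fun ω => B (u i) ω, fun ω => B (u j) ω; Q] = min (u i : ℝ) (u j) from
    fun i j => by rw [hB.covariance_fun_eval]; simp]
  simp only [Complex.ofReal_zero, zero_mul, zero_sub, neg_div]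
  refine congrArg (fun r : ℝ => -((r : ℂ) / 2)) (Finset.sum_congr rfl fun i _ =>
    Finset.sum_congr rfl fun j _ => ?_)
  ring

/-- The partial sum process in the scale `s`. -/
noncomputable def partialSum (X : ℕ → Ω → ℝ) (s : ℝ) (u : ℝ≥0) (ω : Ω) : ℝ :=
  (√s)⁻¹ * walk X ⌊u * s⌋₊ ω

/-- Two initial segments overlap in the shorter one; this is where the Brownian covariance min(u, v)
comes from. -/
lemma sum_indicator_mul_eq {k N : ℕ} (m : Fin k → ℕ) (hm : ∀ i, m i ≤ N) (θ : Fin k → ℝ) :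
    ∑ n ∈ Finset.range N, (∑ i, θ i * (if n < m i then 1 else 0)) ^ 2 =
      ∑ i, ∑ j, θ i * θ j * min (m i : ℝ) (m j) := by
  simp_rw [sq, Finset.sum_mul_sum]
  rw [Finset.sum_comm]
  refine Finset.sum_congr rfl fun i _ => ?_
  rw [Finset.sum_comm]
  refine Finset.sum_congr rfl fun j _ => ?_
  have hcard : ∑ n ∈ Finset.range N, (if n < min (m i) (m j) then (1 : ℝ) else 0) =
      min (m i : ℝ) (m j) := by
    rw [Finset.sum_boole, ← Nat.cast_min]
    congr 1
    rw [show (Finset.range N).filter (fun n => n < min (m i) (m j)) =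
      Finset.range (min (m i) (m j)) by
        ext n
        have := hm i
        simp only [Finset.mem_filter, Finset.mem_range]
        omega, Finset.card_range]
  rw [← hcard, Finset.mul_sum]
  refine Finset.sum_congr rfl fun n _ => ?_
  by_cases h1 : n < m i <;> by_cases h2 : n < m j <;> simp [h1, h2]

lemma sum_mul_walk_eq {k N : ℕ} (m : Fin k → ℕ) (hm : ∀ i, m i ≤ N) (θ : Fin k → ℝ)
    {α : Type*} (X : ℕ → α → ℝ) (ω : α) :
    ∑ i, θ i * walk X (m i) ω =
      ∑ n ∈ Finset.range N, (∑ i, θ i * (if n < m i then 1 else 0)) * X n ω := by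
  simp_rw [Finset.sum_mul]
  rw [Finset.sum_comm]
  refine Finset.sum_congr rfl fun i _ => ?_
  simp_rw [mul_assoc, ← Finset.mul_sum]
  congr 1
  simp only [ite_mul, one_mul, zero_mul]
  rw [← Finset.sum_filter, walk]
  congr 1
  ext n
  have := hm i
  simp only [Finset.mem_filter, Finset.mem_range]
  omega

/-- Convergence of the characteristic functions of the finite-dimensional distributions of the
partial sum process. -/
lemma tendsto_charFun_partialSum [IsProbabilityMeasure P] {X : ℕ → Ω → ℝ} (hindep : iIndepFun X P)
    (hident : ∀ n, IdentDistrib (X n) (X 0) P P) (h0 : P[X 0] = 0) (h1 : P[X 0 ^ 2] = 1)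
    {k : ℕ} (u : Fin k → ℝ≥0) (θ : Fin k → ℝ) :
    Tendsto (fun s : ℝ => charFun (P.map fun ω => ∑ i, θ i * partialSum X s (u i) ω) 1) atTop
      (𝓝 (Complex.exp (-((∑ i, ∑ j, θ i * θ j * min (u i : ℝ) (u j) : ℝ) : ℂ) / 2))) := by
  have hX (n : ℕ) : AEMeasurable (X n) P := (hident n).aemeasurable_fst
  have hprob : IsProbabilityMeasure (P.map (X 0)) := Measure.isProbabilityMeasure_map (hX 0)
  let m : ℝ → Fin k → ℕ := fun s i => ⌊u i * s⌋₊
  let N : ℝ → ℕ := fun s => ∑ i, m s i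
  have hm (s : ℝ) (i : Fin k) : m s i ≤ N s :=
    Finset.single_le_sum (f := m s) (fun _ _ => Nat.zero_le _) (Finset.mem_univ i)
  let a : ℝ → ℕ → ℝ := fun s n => (√s)⁻¹ * ∑ i, θ i * (if n < m s i then 1 else 0)
  have hprod (s : ℝ) : charFun (P.map fun ω => ∑ i, θ i * partialSum X s (u i) ω) 1 =
      ∏ n ∈ Finset.range (N s), charFun (P.map (X 0)) (a s n) := by
    have e : (fun ω => ∑ i, θ i * partialSum X s (u i) ω) =
        fun ω => ∑ n ∈ Finset.range (N s), a s n * X n ω := by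
      ext ω
      have := sum_mul_walk_eq (m s) (hm s) θ X ω
      simp only [a, mul_assoc, ← Finset.mul_sum]
      rw [← this, Finset.mul_sum]
      refine Finset.sum_congr rfl fun i _ => ?_
      simp only [partialSum, m]
      ring
    have hind : iIndepFun (fun n ω => a s n * X n ω) P :=
      hindep.comp (fun n x => a s n * x) (fun n => by fun_prop)
    rw [e, (hind.restrict _).charFun_map_fun_finsetSum_eq_prod
      (fun n _ => (hX n).const_mul _), Finset.prod_apply]
    refine Finset.prod_congr rfl fun n _ => ?_
    rw [charFun_map_mul_comp (hX n), (hident n).map_eq, mul_one]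
  simp_rw [hprod]
  refine tendsto_prod_of_isLittleO (fun t => norm_charFun_le_one t)
    (taylor_charFun_two (hX 0) h0 h1) (fun δ hδ => ?_) ?_
  · have hlim : Tendsto (fun s : ℝ => (√s)⁻¹ * ∑ i, |θ i|) atTop (𝓝 0) := by
      have := (tendsto_inv_atTop_zero.comp Real.tendsto_sqrt_atTop).mul_const (∑ i, |θ i|)
      rwa [zero_mul] at this
    filter_upwards [hlim.eventually_lt_const hδ] with s hs n _
    refine lt_of_le_of_lt ?_ hs
    rw [abs_mul, abs_of_nonneg (inv_nonneg.2 (Real.sqrt_nonneg s))]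
    gcongr
    refine (Finset.abs_sum_le_sum_abs _ _).trans (Finset.sum_le_sum fun i _ => ?_)
    split_ifs <;> simp
  · have hfl (i : Fin k) : Tendsto (fun s : ℝ => (m s i : ℝ) / s) atTop (𝓝 (u i : ℝ)) :=
      tendsto_nat_floor_mul_div_atTop (u i).2
    have hlim : Tendsto (fun s : ℝ => ∑ i, ∑ j, θ i * θ j * min ((m s i : ℝ) / s) ((m s j : ℝ) / s))
        atTop (𝓝 (∑ i, ∑ j, θ i * θ j * min (u i : ℝ) (u j))) :=
      tendsto_finsetSum _ fun i _ => tendsto_finsetSum _ fun j _ =>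
        ((hfl i).min (hfl j)).const_mul _
    refine hlim.congr' ?_
    filter_upwards [eventually_gt_atTop 0] with s hs
    simp only [a, mul_pow, ← Finset.mul_sum, sum_indicator_mul_eq (m s) (hm s) θ]
    rw [inv_pow, Real.sq_sqrt hs.le, Finset.mul_sum]
    refine Finset.sum_congr rfl fun i _ => ?_
    rw [Finset.mul_sum]
    refine Finset.sum_congr rfl fun j _ => ?_
    rw [min_div_div_right hs.le]
    field_simp

lemma aemeasurable_partialSum {X : ℕ → Ω → ℝ} (hX : ∀ n, AEMeasurable (X n) P) (s : ℝ) (u : ℝ≥0) :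
    AEMeasurable (partialSum X s u) P :=
  (Finset.aemeasurable_fun_sum _ fun n _ => hX n).const_mul _

/-- The finite-dimensional distributions of the partial sum process of standardized independent
identically distributed variables converge to those of Brownian motion. -/
theorem fddConverge_partialSum [IsProbabilityMeasure P] [IsProbabilityMeasure Q]
    {X : ℕ → Ω → ℝ} (hindep : iIndepFun X P)
    (hident : ∀ n, IdentDistrib (X n) (X 0) P P) (h0 : P[X 0] = 0) (h1 : P[X 0 ^ 2] = 1)
    {B : ℝ≥0 → Ω' → ℝ} (hB : IsPreBrownianReal B Q) :
    FDDConverge (partialSum X) B P Q := by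
  intro k u
  have hX (s : ℝ) : AEMeasurable (fun ω (i : Fin k) => partialSum X s (u i) ω) P :=
    aemeasurable_pi_lambda _ fun i =>
      aemeasurable_partialSum (fun n => (hident n).aemeasurable_fst) s (u i)
  have hBm : AEMeasurable (fun ω (i : Fin k) => B (u i) ω) Q :=
    aemeasurable_pi_lambda _ fun i => hB.aemeasurable (u i)
  -- Lévy's continuity theorem is applied along an arbitrary sequence of times, in Euclidean space,
  -- where characteristic functions are available.
  refine ⟨hX, hBm, tendsto_of_seq_tendsto fun s hs => ?_⟩
  have hE : TendstoInDistribution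
      (fun (n : ℕ) ω => (WithLp.toLp 2 fun i => partialSum X (s n) (u i) ω :
        EuclideanSpace ℝ (Fin k))) atTop
      (fun ω => WithLp.toLp 2 fun i => B (u i) ω) (fun _ => P) Q :=
    { forall_aemeasurable := fun n =>
        (WithLp.measurable_toLp 2 (Fin k → ℝ)).comp_aemeasurable (hX (s n))
      aemeasurable_limit := (WithLp.measurable_toLp 2 (Fin k → ℝ)).comp_aemeasurable hBm
      tendsto := by
        refine ProbabilityMeasure.tendsto_iff_tendsto_charFun.2 fun θ => ?_
        simp only [ProbabilityMeasure.coe_mk]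
        rw [charFun_map_toLp hBm θ, charFun_map_sum_brownian hB u θ]
        simp_rw [fun n => charFun_map_toLp (hX (s n)) θ]
        exact (tendsto_charFun_partialSum hindep hident h0 h1 u θ).comp hs }
  exact (hE.continuous_comp (PiLp.continuous_ofLp 2 fun _ : Fin k => ℝ)).tendsto

end PartialSums

/-! ### Transfer of the limit to the counting processes -/

section Limit

variable {Ω Ω' : Type*} [MeasurableSpace Ω] [MeasurableSpace Ω'] {P : Measure Ω} {Q : Measure Ω'}

lemma walk_standardize {Ω : Type*} (ξ : ℕ → Ω → ℝ) (μ σ : ℝ) (n : ℕ) (ω : Ω) :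
    walk (fun k ω => (μ - ξ k ω) / σ) n ω = -(walk ξ n ω - μ * n) / σ := by
  rw [walk, ← Finset.sum_div, Finset.sum_sub_distrib, walk]
  simp [mul_comm]

lemma tendstoInMeasure_zero_of_norm_le {ι J E : Type*} [Fintype J] [SeminormedAddCommGroup E]
    {l : Filter ι} {f : ι → Ω → E} {g : J → ι → Ω → ℝ}
    (hg : ∀ j, TendstoInMeasure P (g j) l 0) (C : ℝ)
    (hle : ∀ᶠ i in l, ∀ᵐ ω ∂P, ‖f i ω‖ ≤ C * ∑ j, |g j i ω|) : TendstoInMeasure P f l 0 := by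
  rw [tendstoInMeasure_iff_norm]
  intro ε hε
  -- The added ones avoid division by zero and make |C| · card J · δ strictly less than ε.
  set δ := ε / ((|C| + 1) * (Fintype.card J + 1)) with hδ
  have hδ0 : 0 < δ := by positivity
  have hlim : Tendsto (fun i => ∑ j, P {ω | δ ≤ ‖g j i ω - (0 : Ω → ℝ) ω‖}) l (𝓝 0) := by
    rw [show (0 : ℝ≥0∞) = ∑ j : J, 0 by simp]
    exact tendsto_finsetSum _ fun j _ => tendstoInMeasure_iff_norm.1 (hg j) δ hδ0
  refine tendsto_of_tendsto_of_tendsto_of_le_of_le' tendsto_const_nhds hlim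
    (Eventually.of_forall fun _ => zero_le) ?_
  filter_upwards [hle] with i hi
  refine le_trans (measure_mono_ae ?_) (measure_iUnion_fintype_le P _)
  filter_upwards [hi] with ω hω hmem
  by_contra hcon
  have hlt (j : J) : |g j i ω| ≤ δ := by
    by_contra! hj
    refine hcon (Set.mem_iUnion.2 ⟨j, ?_⟩)
    simpa using hj.le
  have hmem' : ε ≤ ‖f i ω‖ := by
    have : ε ≤ ‖f i ω - (0 : Ω → E) ω‖ := hmem
    simpa using this
  have hsum : ∑ j, |g j i ω| ≤ Fintype.card J * δ := by
    refine (Finset.sum_le_sum fun j _ => hlt j).trans ?_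
    simp
  have hsum0 : 0 ≤ ∑ j, |g j i ω| := Finset.sum_nonneg fun _ _ => abs_nonneg _
  have h1 : ε ≤ |C| * (Fintype.card J * δ) :=
    (hmem'.trans hω).trans (mul_le_mul (le_abs_self C) hsum hsum0 (abs_nonneg C))
  have h2 : ε = (|C| + 1) * (Fintype.card J + 1) * δ := by
    rw [hδ]; field_simp
  have h3 : (0 : ℝ) ≤ Fintype.card J := Nat.cast_nonneg _
  nlinarith [abs_nonneg C, mul_nonneg h3 hδ0.le, mul_nonneg (abs_nonneg C) hδ0.le]

/-- Slutsky's lemma for the convergence of finite-dimensional distributions. -/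
lemma FDDConverge.of_tendstoInMeasure_sub [IsProbabilityMeasure P] [IsProbabilityMeasure Q]
    {E : Type*} [SeminormedAddCommGroup E] [SecondCountableTopology E] [MeasurableSpace E]
    [BorelSpace E] {X Y : ℝ → ℝ≥0 → Ω → E} {Z : ℝ≥0 → Ω' → E} (h : FDDConverge Y Z P Q)
    (hsub : ∀ u, TendstoInMeasure P (fun t ω => X t u ω - Y t u ω) atTop 0)
    (hX : ∀ t u, AEMeasurable (X t u) P) : FDDConverge X Z P Q := by
  intro k u
  refine tendstoInDistribution_of_tendstoInMeasure_sub _ _ (h k u) ?_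
    fun t => aemeasurable_pi_lambda _ fun i => hX t (u i)
  have hnorm (i : Fin k) :
      TendstoInMeasure P (fun t ω => ‖X t (u i) ω - Y t (u i) ω‖) atTop 0 := by
    have := tendstoInMeasure_iff_norm.1 (hsub (u i))
    rw [tendstoInMeasure_iff_norm]
    simpa using this
  refine tendstoInMeasure_zero_of_norm_le hnorm 1 (Eventually.of_forall fun t =>
    Eventually.of_forall fun ω => ?_)
  rw [one_mul, pi_norm_le_iff_of_nonneg (Finset.sum_nonneg fun _ _ => abs_nonneg _)]
  intro i
  refine le_trans ?_ (Finset.single_le_sum (f := fun i => |‖X t (u i) ω - Y t (u i) ω‖|)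
    (fun _ _ => abs_nonneg _) (Finset.mem_univ i))
  exact le_abs_self _

section Normalization

variable {ξ η : ℕ → Ω → ℝ} {μ σ : ℝ} {A : ℝ → Ω → ℕ∞}

/-- A counting process which follows the fluctuation of the walk is, after normalization, close to
the partial sum process of the standardized reflected increments. -/
lemma tendstoInMeasure_normalized_sub [IsProbabilityMeasure P] (hμ : 0 < μ) (hσ : 0 < σ)
    (hA : ∀ t, AEMeasurable (fun ω => ((A t ω).toNat : ℝ)) P)
    (h : TendstoInMeasure P
      (fun t ω => (((A t ω).toNat : ℝ) - t / μ) / √t - fluct μ ξ t ω) atTop 0) (u : ℝ≥0) :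
    TendstoInMeasure P (fun t ω => normalized μ σ A t u ω -
      partialSum (fun k ω => (μ - ξ k ω) / σ) (t / μ) u ω) atTop 0 := by
  have hκ : √(σ ^ 2 * (μ ^ 3)⁻¹) = σ / (μ * √μ) := by
    rw [Real.sqrt_eq_iff_mul_self_eq (by positivity) (by positivity)]
    have := Real.mul_self_sqrt hμ.le
    field_simp
    rw [Real.sq_sqrt hμ.le]
  -- At u = 0 the time ut does not diverge; there a fixed random variable is divided by a diverging
  -- norming. For u > 0, the comparison at time ut is only multiplied by a constant.
  rcases eq_or_lt_of_le (zero_le (a := u)) with rfl | hu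
  · have hlim : Tendsto (fun t : ℝ => √(σ ^ 2 * (μ ^ 3)⁻¹ * t)) atTop atTop :=
      Real.tendsto_sqrt_atTop.comp (tendsto_id.const_mul_atTop (by positivity))
    rw [tendstoInMeasure_iff_norm]
    intro ε hε
    have hm := tendsto_measure_ge_of_identDistrib (P := P)
      (X := fun (_ : ℝ) ω => ((A 0 ω).toNat : ℝ)) (fun _ => IdentDistrib.refl (hA 0))
      (hlim.const_mul_atTop hε)
    refine hm.congr' ?_
    filter_upwards [hlim.eventually_gt_atTop 0] with t ht
    congr 1
    ext ω
    simp only [Set.mem_ofPred_eq, normalized, partialSum, NNReal.coe_zero, zero_mul, mul_zero,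
      sub_zero, Nat.floor_zero, walk, Finset.range_zero, Finset.sum_empty, Pi.zero_apply,
      Real.norm_eq_abs]
    rw [abs_of_nonneg (by positivity), le_div_iff₀ ht]
  · have hu0 : (0 : ℝ) < u := hu
    have hcomp := h.comp (tendsto_id.const_mul_atTop hu0)
    refine tendstoInMeasure_zero_of_norm_le (J := Unit) (fun _ => hcomp)
      (√u / √(σ ^ 2 * (μ ^ 3)⁻¹)) ?_
    filter_upwards [eventually_gt_atTop 0] with t ht
    refine Eventually.of_forall fun ω => le_of_eq ?_
    simp only [Finset.univ_unique, Finset.sum_singleton, Function.comp_apply, id_eq]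
    rw [← abs_of_nonneg (by positivity : 0 ≤ √u / √(σ ^ 2 * (μ ^ 3)⁻¹)), ← abs_mul,
      Real.norm_eq_abs]
    congr 1
    rw [normalized, partialSum, walk_standardize, fluct, ← mul_div_assoc,
      Real.sqrt_mul (by positivity) t, hκ, Real.sqrt_mul hu0.le, Real.sqrt_div ht.le]
    have h1 : 0 < √t := Real.sqrt_pos.2 ht
    have h2 : 0 < √(u : ℝ) := Real.sqrt_pos.2 hu0
    have h3 : 0 < √μ := Real.sqrt_pos.2 hμ
    field_simp

end Normalization

namespace IsIIDPair

variable {ξ η : ℕ → Ω → ℝ} {μ σ : ℝ}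

lemma aemeasurable_tau_toNat (h : IsIIDPair ξ η P) (t : ℝ) :
    AEMeasurable (fun ω => ((tau ξ η t ω).toNat : ℝ)) P :=
  (Measurable.of_discrete (f := fun n : ℕ∞ => (n.toNat : ℝ))).comp_aemeasurable
    (h.aemeasurable_tau t)

lemma aemeasurable_rho_toNat (h : IsIIDPair ξ η P) (t : ℝ) :
    AEMeasurable (fun ω => ((rho ξ η t ω).toNat : ℝ)) P :=
  (Measurable.of_discrete (f := fun n : ℕ∞ => (n.toNat : ℝ))).comp_aemeasurable
    (h.aemeasurable_rho t)

variable [IsProbabilityMeasure P] [IsProbabilityMeasure Q]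

/-- In the scale `√t`, the number of visits follows the fluctuation of the walk. -/
lemma tendstoInMeasure_visits (h : IsIIDPair ξ η P) (hL2 : MemLp (ξ 0) 2 P)
    (hμ : μ = ∫ ω, ξ 0 ω ∂P) (hμ0 : 0 < μ) (hη₁ : Integrable (fun ω => max (η 0 ω) 0) P)
    (hη₂ : Integrable (fun ω => max (-η 0 ω) 0) P) :
    TendstoInMeasure P
      (fun t ω => (((visits ξ η t ω).toNat : ℝ) - t / μ) / √t - fluct μ ξ t ω) atTop 0 := by
  -- Accounts for the additive 1 in τ ≤ N + 1.
  have hconst : TendstoInMeasure P (fun (t : ℝ) (_ : Ω) => (√t)⁻¹) atTop 0 := by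
    rw [tendstoInMeasure_iff_norm]
    intro ε hε
    refine tendsto_const_nhds.congr' ?_
    filter_upwards [(tendsto_inv_atTop_zero.comp Real.tendsto_sqrt_atTop).eventually_lt_const hε]
      with t ht
    symm
    rw [Function.comp_apply] at ht
    convert measure_empty (μ := P) using 2
    refine Set.eq_empty_of_forall_notMem fun ω hω => ?_
    simp only [Set.mem_ofPred_eq, Pi.zero_apply, sub_zero, norm_inv, Real.norm_eq_abs,
      abs_of_nonneg (Real.sqrt_nonneg t)] at hω
    linarith
  refine tendstoInMeasure_zero_of_norm_le (J := Fin 3)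
    (g := ![_, _, _]) (Fin.cases (h.tendstoInMeasure_tau hL2 hμ hμ0 hη₁) (Fin.cases
      (h.tendstoInMeasure_rho hL2 hμ hμ0 hη₂) (Fin.cases hconst (fun i => i.elim0)))) 1 ?_
  filter_upwards [eventually_gt_atTop 0] with t ht
  filter_upwards [h.ae_rho_ne_top (hL2.integrable one_le_two) (hμ ▸ hμ0) hη₂] with ω hω
  have h1 : ((visits ξ η t ω).toNat : ℝ) ≤ (rho ξ η t ω).toNat :=
    Nat.cast_le.2 (visits_toNat_le_rho (hω t))
  have h2 : ((tau ξ η t ω).toNat : ℝ) ≤ (visits ξ η t ω).toNat + 1 := by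
    exact_mod_cast tau_toNat_le_visits (visits_ne_top (hω t))
  have hs : 0 < √t := Real.sqrt_pos.2 ht
  have h3 : (((visits ξ η t ω).toNat : ℝ) - t / μ) / √t ≤
      (((rho ξ η t ω).toNat : ℝ) - t / μ) / √t := by gcongr
  have h4 : (((tau ξ η t ω).toNat : ℝ) - t / μ) / √t ≤
      (((visits ξ η t ω).toNat : ℝ) - t / μ) / √t + (√t)⁻¹ := by
    rw [← one_div, ← add_div]
    gcongr
    linarith
  simp only [Fin.sum_univ_three, Matrix.cons_val_zero, Matrix.cons_val_one, Matrix.cons_val,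
    one_mul, Real.norm_eq_abs]
  have a1 := neg_abs_le ((((tau ξ η t ω).toNat : ℝ) - t / μ) / √t - fluct μ ξ t ω)
  have a2 := le_abs_self ((((rho ξ η t ω).toNat : ℝ) - t / μ) / √t - fluct μ ξ t ω)
  have a3 := le_abs_self (√t)⁻¹
  have b1 := abs_nonneg ((((tau ξ η t ω).toNat : ℝ) - t / μ) / √t - fluct μ ξ t ω)
  have b2 := abs_nonneg ((((rho ξ η t ω).toNat : ℝ) - t / μ) / √t - fluct μ ξ t ω)
  have b3 := abs_nonneg (√t)⁻¹
  rw [abs_le]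
  constructor <;> linarith

/-- The partial sum process of the standardized reflected increments converges to Brownian
motion. -/
lemma fddConverge_standardize (h : IsIIDPair ξ η P) (hL2 : MemLp (ξ 0) 2 P)
    (hμ : μ = ∫ ω, ξ 0 ω ∂P) (hμ0 : 0 < μ) (hσ : σ ^ 2 = variance (ξ 0) P) (hσ0 : 0 < σ)
    {B : ℝ≥0 → Ω' → ℝ} (hB : IsPreBrownianReal B Q) :
    FDDConverge (fun t => partialSum (fun k ω => (μ - ξ k ω) / σ) (t / μ)) B P Q := by
  have h' := h.map (f := fun x => (μ - x.1) / σ) (g := Prod.snd) (by fun_prop) measurable_snd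
  have hint : Integrable (ξ 0) P := hL2.integrable one_le_two
  have hB' := fddConverge_partialSum h'.indep_fst h'.identDistrib_fst ?_ ?_ hB
  · intro k u
    have hk := hB' k u
    exact ⟨fun t => hk.forall_aemeasurable (t / μ), hk.aemeasurable_limit,
      hk.tendsto.comp (tendsto_id.atTop_div_const hμ0)⟩
  · rw [integral_div, integral_sub (integrable_const _) hint, ← hμ]
    simp
  · simp only [Pi.pow_apply, div_pow]
    rw [integral_div, hσ, variance_eq_integral (h.aemeasurable_fst 0), ← hμ]
    simp_rw [sub_sq_comm μ]
    refine div_self ?_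
    rw [hμ, ← variance_eq_integral (h.aemeasurable_fst 0), ← hσ]
    positivity

end IsIIDPair

end Limit

end PerturbedWalk

theorem mainTheorem6
    {Ω₀ Ω Ω' : Type*} [MeasurableSpace Ω₀] [MeasurableSpace Ω] [MeasurableSpace Ω']
    (P₀ : Measure Ω₀) [IsProbabilityMeasure P₀]
    (P : Measure Ω) [IsProbabilityMeasure P]
    (Q : Measure Ω') [IsProbabilityMeasure Q]
    -- the generic vector and its independent copies
    (ξ₀ η₀ : Ω₀ → ℝ) (ξ η : ℕ → Ω → ℝ)
    (hindep : iIndepFun (fun (n : ℕ) (ω : Ω) => (ξ n ω, η n ω)) P)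
    (hident : ∀ n : ℕ, IdentDistrib (fun ω => (ξ n ω, η n ω)) (fun ω => (ξ₀ ω, η₀ ω)) P P₀)
    (μ σ : ℝ) (hL2 : MemLp ξ₀ 2 P₀)
    (hμ : μ = ∫ ω, ξ₀ ω ∂P₀) (hμ_pos : 0 < μ)
    (hσ : σ ^ 2 = variance ξ₀ P₀) (hσ_pos : 0 < σ)
    -- a standard Brownian motion
    (B : ℝ≥0 → Ω' → ℝ) (hB : IsBrownianReal B Q) :
    (Integrable (fun ω => max (η₀ ω) 0) P₀ →
      (∀ᵐ ω ∂P, ∀ t : ℝ, PerturbedWalk.tau ξ η t ω ≠ ⊤) ∧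
      PerturbedWalk.FDDConverge
        (PerturbedWalk.normalized μ σ (PerturbedWalk.tau ξ η)) B P Q) ∧
    (Integrable (fun ω => max (-η₀ ω) 0) P₀ →
      (∀ᵐ ω ∂P, ∀ t : ℝ, PerturbedWalk.rho ξ η t ω ≠ ⊤) ∧
      PerturbedWalk.FDDConverge
        (PerturbedWalk.normalized μ σ (PerturbedWalk.rho ξ η)) B P Q) ∧
    (Integrable η₀ P₀ →
      (∀ᵐ ω ∂P, ∀ t : ℝ, PerturbedWalk.tau ξ η t ω ≠ ⊤ ∧
        PerturbedWalk.visits ξ η t ω ≠ ⊤ ∧ PerturbedWalk.rho ξ η t ω ≠ ⊤) ∧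
      PerturbedWalk.FDDConverge
        (fun t u ω =>
          (PerturbedWalk.normalized μ σ (PerturbedWalk.tau ξ η) t u ω,
           PerturbedWalk.normalized μ σ (PerturbedWalk.visits ξ η) t u ω,
           PerturbedWalk.normalized μ σ (PerturbedWalk.rho ξ η) t u ω))
        (fun u ω => (B u ω, B u ω, B u ω)) P Q) := by

  have h : PerturbedWalk.IsIIDPair ξ η P := ⟨hindep, fun n => (hident n).trans (hident 0).symm⟩
  have hξ0 : IdentDistrib (ξ 0) ξ₀ P P₀ := (hident 0).comp measurable_fst
  have hη0 : IdentDistrib (η 0) η₀ P P₀ := (hident 0).comp measurable_snd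
  have hL2' : MemLp (ξ 0) 2 P := hξ0.memLp_iff.2 hL2
  have hint : Integrable (ξ 0) P := hL2'.integrable one_le_two
  have hμ' : μ = ∫ ω, ξ 0 ω ∂P := hμ.trans hξ0.integral_eq.symm
  have hσ' : σ ^ 2 = variance (ξ 0) P := hσ.trans hξ0.variance_eq.symm
  have hfdd := h.fddConverge_standardize hL2' hμ' hμ_pos hσ' hσ_pos hB.toIsPreBrownianReal
  have hpos (hη : Integrable (fun ω => max (η₀ ω) 0) P₀) :
      Integrable (fun ω => max (η 0 ω) 0) P :=
    (hη0.comp (u := fun x => max x 0) (by fun_prop)).integrable_iff.2 hη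
  have hneg (hη : Integrable (fun ω => max (-η₀ ω) 0) P₀) :
      Integrable (fun ω => max (-η 0 ω) 0) P :=
    (hη0.comp (u := fun x => max (-x) 0) (by fun_prop)).integrable_iff.2 hη
  have hmeas {A : ℝ → Ω → ℕ∞} (hA : ∀ t, AEMeasurable (fun ω => ((A t ω).toNat : ℝ)) P) (t : ℝ)
      (u : ℝ≥0) : AEMeasurable (PerturbedWalk.normalized μ σ A t u) P :=
    ((hA _).sub_const _).div_const _
  have htau := h.ae_tau_ne_top hL2' hμ' hμ_pos
  have hrho (hη : Integrable (fun ω => max (-η 0 ω) 0) P) :=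
    h.ae_rho_ne_top hint (hμ' ▸ hμ_pos) hη
  refine ⟨fun hη => ⟨htau, ?_⟩, fun hη => ⟨hrho (hneg hη), ?_⟩, fun hη => ⟨?_, ?_⟩⟩
  · exact hfdd.of_tendstoInMeasure_sub (PerturbedWalk.tendstoInMeasure_normalized_sub hμ_pos hσ_pos
      h.aemeasurable_tau_toNat (h.tendstoInMeasure_tau hL2' hμ' hμ_pos (hpos hη)))
      (hmeas h.aemeasurable_tau_toNat)
  · exact hfdd.of_tendstoInMeasure_sub (PerturbedWalk.tendstoInMeasure_normalized_sub hμ_pos hσ_pos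
      h.aemeasurable_rho_toNat (h.tendstoInMeasure_rho hL2' hμ' hμ_pos (hneg hη)))
      (hmeas h.aemeasurable_rho_toNat)
  · filter_upwards [htau, hrho (hneg hη.neg.pos_part)] with ω h1 h2 t
    exact ⟨h1 t, PerturbedWalk.visits_ne_top (h2 t), h2 t⟩
  · have hη₁ := hpos hη.pos_part
    have hη₂ := hneg hη.neg.pos_part
    -- The diagonal map x ↦ (x, x, x) is continuous, so the joint limit has the same Brownian motion
    -- in each component.
    have htriple : PerturbedWalk.FDDConverge
        (fun t u ω => (PerturbedWalk.partialSum (fun k ω => (μ - ξ k ω) / σ) (t / μ) u ω,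
          PerturbedWalk.partialSum (fun k ω => (μ - ξ k ω) / σ) (t / μ) u ω,
          PerturbedWalk.partialSum (fun k ω => (μ - ξ k ω) / σ) (t / μ) u ω))
        (fun u ω => (B u ω, B u ω, B u ω)) P Q := fun k u =>
      (hfdd k u).continuous_comp (g := fun (x : Fin k → ℝ) i => (x i, x i, x i)) (by fun_prop)
    refine htriple.of_tendstoInMeasure_sub (fun u => ?_) fun t u =>
      (hmeas h.aemeasurable_tau_toNat t u).prodMk
        ((hmeas h.aemeasurable_visits t u).prodMk (hmeas h.aemeasurable_rho_toNat t u))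
    have k1 := PerturbedWalk.tendstoInMeasure_normalized_sub hμ_pos hσ_pos h.aemeasurable_tau_toNat
      (h.tendstoInMeasure_tau hL2' hμ' hμ_pos hη₁) u
    have k2 := PerturbedWalk.tendstoInMeasure_normalized_sub hμ_pos hσ_pos h.aemeasurable_visits
      (h.tendstoInMeasure_visits hL2' hμ' hμ_pos hη₁ hη₂) u
    have k3 := PerturbedWalk.tendstoInMeasure_normalized_sub hμ_pos hσ_pos h.aemeasurable_rho_toNat
      (h.tendstoInMeasure_rho hL2' hμ' hμ_pos hη₂) u
    refine PerturbedWalk.tendstoInMeasure_zero_of_norm_le (J := Fin 3)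
      (g := ![_, _, _]) (Fin.cases k1 (Fin.cases k2 (Fin.cases k3 (fun i => i.elim0)))) 1
      (Eventually.of_forall fun t => Eventually.of_forall fun ω => ?_)
    simp only [Fin.sum_univ_three, Matrix.cons_val_zero, Matrix.cons_val_one, Matrix.cons_val,
      one_mul, Prod.mk_sub_mk]
    refine norm_prod_le_iff.2 ⟨?_, norm_prod_le_iff.2 ⟨?_, ?_⟩⟩ <;>
      simp only [Real.norm_eq_abs, add_assoc]
    · exact le_add_of_nonneg_right (by positivity)
    · exact le_add_of_nonneg_of_le (abs_nonneg _) (le_add_of_nonneg_right (abs_nonneg _))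
    · exact le_add_of_nonneg_of_le (abs_nonneg _) (le_add_of_nonneg_left (abs_nonneg _))
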